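/- **Theorem (weak cohomology of cut \& project tilings of dimension and codimension one).** Let $\theta\in\mathbb R$ be irrational, let $E\subset\mathbb R^2$ be the line through $0$ of slope $\theta$, and let $K\subset E^\perp$ be a non-empty compact set which is the closure of its interior and such that no point of $\mathbb Z^2$ lies on the boundary of $K+E$. Let $\mathcal P$ be the tiling of $E\cong\mathbb R$ by compact intervals whose endpoints (vertices) are the orthogonal projections to $E$ of the points of $\mathbb Z^2\cap(K+E)$. Then the first weak tiling cohomology of $\mathcal P$ with real coefficients is infinitely generated, i.e. an infinite-dimensional real vector space (in particular it is not finitely generated as an abelian group). This holds for each of the following descriptions of it. Let $\Omega$ be the hull of $\mathcal P$, the closure of $\{\mathcal P-x : x\in\mathbb R\}$ in the space of tilings with the metric $$D(\mathcal P_1,\mathcal P_2)=\inf\Big\{\tfrac1{r+1} : r>0,\ \exists\,x,y\in B_{1/r}(0)\ \text{such that } \mathcal P_1-x \text{ and } \mathcal P_2-y \text{ have the same vertices in } B_r(0)\Big\},$$ let $\Xi^0\subset\Omega$ be the set of tilings with a vertex at $0$, and $\Xi^1\subset\Omega$ the set of tilings having a tile with midpoint $0$. 1. *Weak PV-cohomology:*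 $C(\Xi^1,\mathbb R)/d_{PV}\,C(\Xi^0,\mathbb R)$, where $(d_{PV}f)(\xi)=f(\xi-b)-f(\xi-a)$ if $[a,b]$ is the tile of $\xi$ with midpoint $0$. 2. *Weak pattern equivariant simplicial cohomology:* $C^1_w/\delta\, C^0_w$, where $C^n_w$ is the closure in the sup-norm of the space of bounded real functions $c$ on the $n$-simplices of $\mathcal P$ (vertices for $n=0$, tiles for $n=1$) for which there is $k$ such that the value of $c$ on a simplex depends only on the translation class of the simplex together with the $k$ tiles following it on either side, and $(\delta c)([a,b])=c(b)-c(a)$. 3. *Weak pattern equivariant de Rham cohomology:* $\mathcal A_w\,dx/d\mathcal A_w$, where $\mathcal A_w$ is the closure, with respect to the seminorms $s_k(f)=\max_{j\le k}\|f^{(j)}\|_\infty$ on the smooth functions with all derivatives bounded, of those such functions $f$ for which there is $R>0$ such that $f(x)=f(y)$ whenever $\mathcal P-x$ and $\mathcal P-y$ have the same vertices in $B_R(0)$. 4. *Group cohomology:* $H^1(\mathbb Z,C(\Xi^0,\mathbb R))$, where $n\in\mathbb Z$ acts by $f\mapsto f\circ\varphi^n$ and $\varphi:\Xi^0\to\Xi^0$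 is the first return map of the translation flow, $\varphi(\xi)=\xi-v$ with $v$ the smallest positive vertex of $\xi$. -/

import Mathlib

noncomputable section

namespace TilingCohomology

/-! ### One-dimensional tilings and the metric on tilings -/

/-- A tiling of `ℝ` by compact intervals, encoded by the set of endpoints of its tiles. -/
@[ext]
structure Tiling where
  vertices : Set ℝ
  finite_inter : ∀ r : ℝ, (vertices ∩ Set.Icc (-r) r).Finite
  unbounded_above : ∀ r : ℝ, ∃ v ∈ vertices, r < v
  unbounded_below : ∀ r : ℝ, ∃ v ∈ vertices, v < r

namespace Tiling

/-- `[a, b]` is a tile of `P`. -/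
def IsTile (P : Tiling) (a b : ℝ) : Prop :=
  a ∈ P.vertices ∧ b ∈ P.vertices ∧ a < b ∧ ∀ c ∈ P.vertices, ¬ (a < c ∧ c < b)

/-- The translated tiling `P - x`. -/
def translate (x : ℝ) (P : Tiling) : Tiling where
  vertices := {v | v + x ∈ P.vertices}
  finite_inter r := by
    refine ((P.finite_inter (r + |x|)).preimage
      (f := fun v => v + x) (add_left_injective x).injOn).subset ?_
    rintro v ⟨hv, h1, h2⟩
    have := neg_abs_le x
    have := le_abs_self x
    exact ⟨hv, by linarith, by linarith⟩
  unbounded_above r := by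
    obtain ⟨v, hv, h⟩ := P.unbounded_above (r + x)
    exact ⟨v - x, by simpa using hv, by linarith⟩
  unbounded_below r := by
    obtain ⟨v, hv, h⟩ := P.unbounded_below (r + x)
    exact ⟨v - x, by simpa using hv, by linarith⟩

/-- `P` and `Q` coincide on the `r`-ball around `0`. -/
def Agree (r : ℝ) (P Q : Tiling) : Prop :=
  P.vertices ∩ Metric.ball 0 r = Q.vertices ∩ Metric.ball 0 r

/-- The set of numbers `1 / (r + 1)`, `r > 0`, such that `P` and `Q` coincide on the `r`-ball
after translations by vectors of length less than `1 / r`. -/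
def distSet (P Q : Tiling) : Set ℝ :=
  {δ | ∃ r : ℝ, 0 < r ∧ δ = 1 / (r + 1) ∧
    ∃ x ∈ Metric.ball (0 : ℝ) (1 / r), ∃ y ∈ Metric.ball (0 : ℝ) (1 / r),
      Agree r (P.translate x) (Q.translate y)}

theorem mem_translate {x v : ℝ} {P : Tiling} :
    v ∈ (P.translate x).vertices ↔ v + x ∈ P.vertices := Iff.rfl

theorem translate_translate (x y : ℝ) (P : Tiling) :
    (P.translate x).translate y = P.translate (x + y) := by
  ext v; simp only [mem_translate]; rw [show v + y + x = v + (x + y) by ring]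

theorem translate_zero (P : Tiling) : P.translate 0 = P := by
  ext v; simp [mem_translate]

theorem agree_iff {r : ℝ} {P Q : Tiling} :
    Agree r P Q ↔ ∀ v, |v| < r → (v ∈ P.vertices ↔ v ∈ Q.vertices) := by
  simp only [Agree, Set.ext_iff, Set.mem_inter_iff, Metric.mem_ball, dist_zero_right,
    Real.norm_eq_abs]
  exact forall_congr' fun v => by tauto

theorem Agree.symm {r : ℝ} {P Q : Tiling} (h : Agree r P Q) : Agree r Q P := Eq.symm h

theorem Agree.translate {r : ℝ} {P Q : Tiling} (h : Agree r P Q) (x : ℝ) :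
    Agree (r - |x|) (P.translate x) (Q.translate x) := by
  rw [agree_iff] at *
  intro v hv
  exact h (v + x) (by linarith [abs_add_le v x])

theorem Agree.mono {r s : ℝ} {P Q : Tiling} (h : Agree r P Q) (hs : s ≤ r) : Agree s P Q := by
  rw [agree_iff] at *
  exact fun v hv => h v (hv.trans_le hs)

theorem exists_empty_ball (P : Tiling) : ∃ x r : ℝ, 0 < r ∧ ∀ v ∈ P.vertices, r ≤ |v - x| := by
  have hfin := P.finite_inter 1
  have hinf : (Set.Ioo (-1 : ℝ) 1).Infinite := Set.Ioo_infinite (by norm_num)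
  obtain ⟨x, hx, hxn⟩ := (hinf.sdiff hfin).nonempty
  have hopen : IsOpen (Set.Ioo (-1 : ℝ) 1 \ (P.vertices ∩ Set.Icc (-1) 1)) :=
    isOpen_Ioo.sdiff hfin.isClosed
  obtain ⟨r, hr, hsub⟩ := Metric.isOpen_iff.1 hopen x ⟨hx, hxn⟩
  refine ⟨x, r, hr, fun v hv => ?_⟩
  by_contra hlt
  have := hsub (show v ∈ Metric.ball x r by
    rw [Metric.mem_ball, Real.dist_eq]; exact not_le.1 hlt)
  exact this.2 ⟨hv, this.1.1.le, this.1.2.le⟩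

theorem distSet_nonempty (P Q : Tiling) : (distSet P Q).Nonempty := by
  obtain ⟨x, r, hr, hP⟩ := exists_empty_ball P
  obtain ⟨y, s, hs, hQ⟩ := exists_empty_ball Q
  have hM : 0 < |x| + |y| + 1 := by positivity
  set t := min (min r s) (1 / (|x| + |y| + 1)) with ht
  have ht0 : 0 < t := by positivity
  have htr : t ≤ r := (min_le_left _ _).trans (min_le_left _ _)
  have hts : t ≤ s := (min_le_left _ _).trans (min_le_right _ _)
  have htM : |x| + |y| + 1 ≤ 1 / t := by
    rw [le_div_iff₀ ht0, mul_comm, ← le_div_iff₀ hM]; exact min_le_right _ _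
  refine ⟨_, t, ht0, rfl, x, ?_, y, ?_, ?_⟩
  · rw [mem_ball_zero_iff, Real.norm_eq_abs]; linarith [abs_nonneg y]
  · rw [mem_ball_zero_iff, Real.norm_eq_abs]; linarith [abs_nonneg x]
  · rw [agree_iff]
    intro v hv
    refine iff_of_false (fun h => ?_) (fun h => ?_)
    · have := hP _ h; rw [add_sub_cancel_right] at this; linarith
    · have := hQ _ h; rw [add_sub_cancel_right] at this; linarith

theorem distSet_bddBelow (P Q : Tiling) : BddBelow (distSet P Q) :=
  ⟨0, by rintro _ ⟨r, hr, rfl, -⟩; positivity⟩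

theorem distSet_symm (P Q : Tiling) : distSet P Q = distSet Q P := by
  ext δ
  constructor <;>
  · rintro ⟨r, hr, h, x, hx, y, hy, ha⟩
    exact ⟨r, hr, h, y, hy, x, hx, ha.symm⟩

theorem sInf_distSet_le_one (P Q : Tiling) : sInf (distSet P Q) ≤ 1 := by
  obtain ⟨δ, hδ⟩ := distSet_nonempty P Q
  refine (csInf_le (distSet_bddBelow P Q) hδ).trans ?_
  obtain ⟨r, hr, rfl, -⟩ := hδ
  rw [div_le_one (by positivity)]; linarith

theorem sInf_distSet_triangle (P Q R : Tiling) :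
    sInf (distSet P R) ≤ sInf (distSet P Q) + sInf (distSet Q R) := by
  have key : ∀ a ∈ distSet P Q, ∀ b ∈ distSet Q R, sInf (distSet P R) ≤ a + b := by
    rintro _ ⟨r, hr, rfl, x, hx, y, hy, h1⟩ _ ⟨s, hs, rfl, z, hz, w, hw, h2⟩
    rw [mem_ball_zero_iff, Real.norm_eq_abs] at hx hy hz hw
    by_cases hrs : r * s ≤ 1
    · refine (sInf_distSet_le_one P R).trans ?_
      rw [div_add_div _ _ (by positivity) (by positivity), le_div_iff₀ (by positivity)]
      nlinarith
    · have hrs' : 0 < r * s - 1 := by linarith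
      set t := (r * s - 1) / (r + s + 2) with ht
      have ht0 : 0 < t := by positivity
      have e1 : 1 / (t + 1) = 1 / (r + 1) + 1 / (s + 1) := by
        rw [ht]
        have : r * s - 1 + (r + s + 2) ≠ 0 := by positivity
        field_simp
        ring
      have e2 : 1 / r + 1 / s ≤ 1 / t := by
        rw [ht, one_div_div, div_add_div _ _ hr.ne' hs.ne', div_le_div_iff₀ (by positivity) hrs']
        nlinarith [mul_pos hr hs]
      have e3 : t ≤ r - 1 / s := by
        rw [ht, show r - 1 / s = (r * s - 1) / s by field_simp]
        exact div_le_div_of_nonneg_left hrs'.le hs (by linarith)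
      have e4 : t ≤ s - 1 / r := by
        rw [ht, show s - 1 / r = (r * s - 1) / r by field_simp]
        exact div_le_div_of_nonneg_left hrs'.le hr (by linarith)
      rw [← e1]
      refine csInf_le (distSet_bddBelow P R) ⟨t, ht0, rfl, x + z, ?_, w + y, ?_, ?_⟩
      · rw [mem_ball_zero_iff, Real.norm_eq_abs]; linarith [abs_add_le x z]
      · rw [mem_ball_zero_iff, Real.norm_eq_abs]; linarith [abs_add_le w y]
      · have h1' := (h1.translate z).mono (s := t) (by linarith)
        have h2' := (h2.translate y).mono (s := t) (by linarith)
        rw [translate_translate, translate_translate] at h1' h2'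
        rw [add_comm y z] at h1'
        exact Eq.trans h1' h2'
  have h : ∀ a ∈ distSet P Q, sInf (distSet P R) - a ≤ sInf (distSet Q R) := fun a ha =>
    le_csInf (distSet_nonempty _ _) fun b hb => by linarith [key a ha b hb]
  have : sInf (distSet P R) - sInf (distSet Q R) ≤ sInf (distSet P Q) :=
    le_csInf (distSet_nonempty _ _) fun a ha => by linarith [h a ha]
  linarith

theorem sInf_distSet_le_of_agree {r : ℝ} (hr : 0 < r) {P Q : Tiling} (h : Agree r P Q) :
    sInf (distSet P Q) ≤ 1 / (r + 1) := by
  refine csInf_le (distSet_bddBelow P Q) ⟨r, hr, rfl, 0, ?_, 0, ?_, ?_⟩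
  · simpa using hr
  · simpa using hr
  · simpa only [translate_zero] using h

/-- The tiling metric
`D(P, Q) = inf {1 / (r + 1) | ∃ x y ∈ B_{1/r}(0), B_r[P - x] = B_r[Q - y]}`. -/
instance : PseudoMetricSpace Tiling where
  dist P Q := sInf (distSet P Q)
  dist_self P := by
    refine le_antisymm (le_of_forall_pos_le_add fun ε hε => ?_)
      (le_csInf (distSet_nonempty _ _) ?_)
    · refine (sInf_distSet_le_of_agree (r := 1 / ε) (by positivity) rfl).trans ?_
      rw [zero_add, div_le_iff₀ (by positivity), mul_add, mul_one_div_cancel hε.ne']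
      linarith
    · rintro _ ⟨r, hr, rfl, -⟩; positivity
  dist_comm P Q := by rw [distSet_symm]
  dist_triangle := sInf_distSet_triangle

theorem dist_le_of_agree {r : ℝ} (hr : 0 < r) {P Q : Tiling} (h : Agree r P Q) :
    dist P Q ≤ 1 / (r + 1) := sInf_distSet_le_of_agree hr h

theorem exists_near {P Q : Tiling} {R : ℝ} (hR : 0 < R) (h : dist P Q < 1 / (R + 1)) :
    ∃ r, R < r ∧ ∃ x ∈ Metric.ball (0 : ℝ) (1 / r), ∃ y ∈ Metric.ball (0 : ℝ) (1 / r),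
      Agree r (P.translate x) (Q.translate y) := by
  obtain ⟨_, ⟨r, hr, rfl, hxy⟩, hlt⟩ := exists_lt_of_csInf_lt (distSet_nonempty P Q) h
  refine ⟨r, ?_, hxy⟩
  have := (one_div_lt_one_div (by positivity) (by positivity)).1 hlt
  linarith

theorem continuous_translate (x : ℝ) : Continuous (translate x) := by
  rw [Metric.continuous_iff]
  intro P ε hε
  set R := 1 / ε + |x| with hRdef
  have hR : 0 < R := by positivity
  refine ⟨1 / (R + 1), by positivity, fun Q hQ => ?_⟩
  obtain ⟨r, hr, a, ha, b, hb, h⟩ := exists_near hR hQ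
  have hε' : 1 / ε < r - |x| := by linarith
  have hpos : 0 < r - |x| := lt_trans (by positivity) hε'
  have hle : 1 / r ≤ 1 / (r - |x|) :=
    one_div_le_one_div_of_le hpos (by linarith [abs_nonneg x])
  have : dist (Q.translate x) (P.translate x) ≤ 1 / (r - |x| + 1) := by
    refine csInf_le (distSet_bddBelow _ _) ⟨r - |x|, hpos, rfl, a,
      Metric.ball_subset_ball hle ha, b, Metric.ball_subset_ball hle hb, ?_⟩
    have := h.translate x
    simpa only [translate_translate, add_comm x] using this
  refine this.trans_lt ?_
  rw [div_lt_iff₀ (by linarith)]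
  rw [div_lt_iff₀ hε] at hε'
  nlinarith

/-! ### Neighbouring vertices -/

/-- The first vertex to the right of `x`. -/
def next (P : Tiling) (x : ℝ) : ℝ := sInf {v ∈ P.vertices | x < v}

/-- The first vertex to the left of `x`. -/
def prev (P : Tiling) (x : ℝ) : ℝ := sSup {v ∈ P.vertices | v < x}

theorem isLeast_next (P : Tiling) (x : ℝ) : IsLeast {v ∈ P.vertices | x < v} (P.next x) := by
  obtain ⟨w, hw, hxw⟩ := P.unbounded_above x
  have hfin : ({v ∈ P.vertices | x < v} ∩ Set.Iic w).Finite := by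
    refine (P.finite_inter (|x| + |w|)).subset ?_
    rintro v ⟨⟨hv, h1⟩, h2⟩
    have h2 : v ≤ w := h2
    exact ⟨hv, by linarith [neg_abs_le x, abs_nonneg w], by linarith [le_abs_self w, abs_nonneg x]⟩
  obtain ⟨m, hm, hmin⟩ := Set.exists_min_image _ id hfin ⟨w, ⟨hw, hxw⟩, le_refl w⟩
  have : IsLeast {v ∈ P.vertices | x < v} m := by
    refine ⟨hm.1, fun v hv => ?_⟩
    by_cases hvw : v ≤ w
    · exact hmin v ⟨hv, hvw⟩
    · exact le_trans hm.2 (not_le.1 hvw).le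
  rwa [next, this.csInf_eq]

theorem isGreatest_prev (P : Tiling) (x : ℝ) :
    IsGreatest {v ∈ P.vertices | v < x} (P.prev x) := by
  obtain ⟨w, hw, hxw⟩ := P.unbounded_below x
  have hfin : ({v ∈ P.vertices | v < x} ∩ Set.Ici w).Finite := by
    refine (P.finite_inter (|x| + |w|)).subset ?_
    rintro v ⟨⟨hv, h1⟩, h2⟩
    have h2 : w ≤ v := h2
    exact ⟨hv, by linarith [neg_abs_le w, abs_nonneg x], by linarith [le_abs_self x, abs_nonneg w]⟩
  obtain ⟨m, hm, hmax⟩ := Set.exists_max_image _ id hfin ⟨w, ⟨hw, hxw⟩, le_refl w⟩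
  have : IsGreatest {v ∈ P.vertices | v < x} m := by
    refine ⟨hm.1, fun v hv => ?_⟩
    by_cases hvw : w ≤ v
    · exact hmax v ⟨hv, hvw⟩
    · exact le_trans (not_le.1 hvw).le hm.2
  rwa [prev, this.csSup_eq]

theorem next_mem (P : Tiling) (x : ℝ) : P.next x ∈ P.vertices := (P.isLeast_next x).1.1

theorem lt_next (P : Tiling) (x : ℝ) : x < P.next x := (P.isLeast_next x).1.2

theorem prev_mem (P : Tiling) (x : ℝ) : P.prev x ∈ P.vertices := (P.isGreatest_prev x).1.1

theorem prev_lt (P : Tiling) (x : ℝ) : P.prev x < x := (P.isGreatest_prev x).1.2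

theorem next_eq {P : Tiling} {x v : ℝ} (hv : v ∈ P.vertices) (hx : x < v)
    (h : ∀ w ∈ P.vertices, x < w → v ≤ w) : P.next x = v :=
  (P.isLeast_next x).unique ⟨⟨hv, hx⟩, fun w hw => h w hw.1 hw.2⟩

theorem prev_eq {P : Tiling} {x v : ℝ} (hv : v ∈ P.vertices) (hx : v < x)
    (h : ∀ w ∈ P.vertices, w < x → w ≤ v) : P.prev x = v :=
  (P.isGreatest_prev x).unique ⟨⟨hv, hx⟩, fun w hw => h w hw.1 hw.2⟩

theorem next_translate (P : Tiling) (x y : ℝ) : (P.translate y).next x = P.next (x + y) - y := by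
  refine next_eq ?_ ?_ fun w hw hxw => ?_
  · rw [mem_translate, sub_add_cancel]; exact P.next_mem _
  · linarith [P.lt_next (x + y)]
  · linarith [(P.isLeast_next (x + y)).2 ⟨mem_translate.1 hw, by linarith⟩]

theorem prev_translate (P : Tiling) (x y : ℝ) : (P.translate y).prev x = P.prev (x + y) - y := by
  refine prev_eq ?_ ?_ fun w hw hxw => ?_
  · rw [mem_translate, sub_add_cancel]; exact P.prev_mem _
  · linarith [P.prev_lt (x + y)]
  · linarith [(P.isGreatest_prev (x + y)).2 ⟨mem_translate.1 hw, by linarith⟩]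

theorem prev_next {P : Tiling} {x : ℝ} (hx : x ∈ P.vertices) : P.prev (P.next x) = x :=
  prev_eq hx (P.lt_next x) fun w hw hlt => by
    by_contra hxw
    linarith [(P.isLeast_next x).2 ⟨hw, not_le.1 hxw⟩]

theorem next_prev {P : Tiling} {x : ℝ} (hx : x ∈ P.vertices) : P.next (P.prev x) = x :=
  next_eq hx (P.prev_lt x) fun w hw hlt => by
    by_contra hxw
    linarith [(P.isGreatest_prev x).2 ⟨hw, not_le.1 hxw⟩]

theorem Agree.next_eq {R : ℝ} {P Q : Tiling} (h : Agree R P Q) (hv : P.next 0 < R) :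
    Q.next 0 = P.next 0 := by
  rw [agree_iff] at h
  have h0 := P.lt_next 0
  refine Tiling.next_eq ((h _ (by rwa [abs_of_pos h0])).1 (P.next_mem 0)) h0 fun w hw hw0 => ?_
  by_contra hlt
  have hw' := (h w (by rw [abs_of_pos hw0]; linarith)).2 hw
  exact hlt ((P.isLeast_next 0).2 ⟨hw', hw0⟩)

theorem Agree.prev_eq {R : ℝ} {P Q : Tiling} (h : Agree R P Q) (hv : -P.prev 0 < R) :
    Q.prev 0 = P.prev 0 := by
  rw [agree_iff] at h
  have h0 := P.prev_lt 0
  refine Tiling.prev_eq ((h _ (by rwa [abs_of_neg h0])).1 (P.prev_mem 0)) h0 fun w hw hw0 => ?_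
  by_contra hlt
  have hw' := (h w (by rw [abs_of_neg hw0]; linarith)).2 hw
  exact hlt ((P.isGreatest_prev 0).2 ⟨hw', hw0⟩)

/-- Translation of `P` by its first vertex to the right of `0`. -/
def toNext (P : Tiling) : Tiling := P.translate (P.next 0)

/-- Translation of `P` by its first vertex to the left of `0`. -/
def toPrev (P : Tiling) : Tiling := P.translate (P.prev 0)

/-! ### The hull and the transversals -/

/-- The hull: the closure of the translation orbit with respect to the tiling metric. -/
def hull (P : Tiling) : Set Tiling := closure (Set.range fun x : ℝ => P.translate x)

theorem translate_mem_hull {P Q : Tiling} (hQ : Q ∈ P.hull) (x : ℝ) : Q.translate x ∈ P.hull := by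
  refine map_mem_closure (continuous_translate x) hQ ?_
  rintro _ ⟨y, rfl⟩
  exact ⟨y + x, (translate_translate y x P).symm⟩

/-- The transversal `Ξ⁰`: tilings in the hull with a vertex at `0`. -/
def transversal₀ (P : Tiling) : Set Tiling := {Q ∈ P.hull | 0 ∈ Q.vertices}

/-- The transversal `Ξ¹`: tilings in the hull having a tile whose puncture, its barycentre,
is `0`. -/
def transversal₁ (P : Tiling) : Set Tiling :=
  {Q ∈ P.hull | ∃ a b : ℝ, Q.IsTile a b ∧ (a + b) / 2 = 0}

theorem toNext_mem {P Q : Tiling} (hQ : Q ∈ P.hull) : Q.toNext ∈ P.transversal₀ :=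
  ⟨translate_mem_hull hQ _, by
    show 0 + Q.next 0 ∈ Q.vertices
    rw [zero_add]; exact Q.next_mem 0⟩

theorem toPrev_mem {P Q : Tiling} (hQ : Q ∈ P.hull) : Q.toPrev ∈ P.transversal₀ :=
  ⟨translate_mem_hull hQ _, by
    show 0 + Q.prev 0 ∈ Q.vertices
    rw [zero_add]; exact Q.prev_mem 0⟩

theorem toPrev_toNext {Q : Tiling} (h0 : 0 ∈ Q.vertices) : Q.toNext.toPrev = Q := by
  rw [toPrev, toNext, prev_translate, translate_translate, zero_add, prev_next h0,
    zero_sub, add_neg_cancel, translate_zero]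

theorem toNext_toPrev {Q : Tiling} (h0 : 0 ∈ Q.vertices) : Q.toPrev.toNext = Q := by
  rw [toNext, toPrev, next_translate, translate_translate, zero_add, next_prev h0,
    zero_sub, add_neg_cancel, translate_zero]

/-- Two tilings that are close in the tiling metric agree on a large ball up to a small shift. -/
theorem exists_shift {R η : ℝ} (hR : 0 < R) (hη : 0 < η) :
    ∃ ε > 0, ∀ P Q : Tiling, dist P Q < ε →
      ∃ s, |s| < η ∧ ∀ w, |w| < R → (w ∈ Q.vertices ↔ w + s ∈ P.vertices) := by
  have hS : 0 < R + 1 + 2 / η := by positivity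
  refine ⟨1 / (R + 1 + 2 / η + 1), by positivity, fun P Q h => ?_⟩
  obtain ⟨r, hr, x, hx, y, hy, ha⟩ := exists_near hS h
  rw [mem_ball_zero_iff, Real.norm_eq_abs] at hx hy
  have hη2 : 0 < 2 / η := by positivity
  have hr0 : 0 < r := by linarith
  have h1r : 1 / r ≤ 1 := by rw [div_le_one hr0]; linarith
  have h2r : 2 / r < η := by
    rw [div_lt_comm₀ hr0 hη]; linarith
  rw [agree_iff] at ha
  refine ⟨x - y, ?_, fun w hw => ?_⟩
  · have := abs_sub x y
    have : 2 / r = 1 / r + 1 / r := by ring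
    linarith
  · have := ha (w - y) (by linarith [abs_sub w y])
    rw [mem_translate, mem_translate, sub_add_cancel] at this
    rw [← this, show w - y + x = w + (x - y) by ring]

theorem exists_agree_of_vertex (P : Tiling) (R : ℝ) :
    ∃ ε > 0, ∀ Q : Tiling, 0 ∈ Q.vertices → dist P Q < ε → Agree R P Q := by
  have h1 := P.lt_next 0
  have h2 := P.prev_lt 0
  obtain ⟨ε, hε, H⟩ := exists_shift (R := |R| + 1) (η := min (P.next 0) (-P.prev 0))
    (by positivity) (lt_min h1 (by linarith))
  refine ⟨ε, hε, fun Q hQ hd => ?_⟩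
  obtain ⟨s, hs, hw⟩ := H P Q hd
  have hsP : s ∈ P.vertices := by
    simpa using (hw 0 (by rw [abs_zero]; positivity)).1 hQ
  have hs0 : s = 0 := by
    rcases lt_trichotomy s 0 with h | h | h
    · have := (P.isGreatest_prev 0).2 ⟨hsP, h⟩
      have := hs.trans_le (min_le_right _ _)
      rw [abs_of_neg h] at this
      linarith
    · exact h
    · have := (P.isLeast_next 0).2 ⟨hsP, h⟩
      have := hs.trans_le (min_le_left _ _)
      rw [abs_of_pos h] at this
      linarith
  rw [agree_iff]
  intro v hv
  rw [hw v (by linarith [le_abs_self R]), hs0, add_zero]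

theorem next_prev_of_puncture {P : Tiling} {a b : ℝ} (h : P.IsTile a b) (h0 : (a + b) / 2 = 0) :
    P.next 0 = b ∧ P.prev 0 = a := by
  obtain ⟨ha, hb, hab, hc⟩ := h
  refine ⟨next_eq hb (by linarith) fun w hw hw0 => ?_, prev_eq ha (by linarith) fun w hw hw0 => ?_⟩
  · by_contra hlt
    exact hc w hw ⟨by linarith, not_le.1 hlt⟩
  · by_contra hlt
    exact hc w hw ⟨not_le.1 hlt, by linarith⟩

theorem exists_agree_of_puncture {P : Tiling} (hP : ∃ a b : ℝ, P.IsTile a b ∧ (a + b) / 2 = 0)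
    (R : ℝ) :
    ∃ ε > 0, ∀ Q : Tiling, (∃ a b : ℝ, Q.IsTile a b ∧ (a + b) / 2 = 0) → dist P Q < ε →
      Agree R P Q := by
  obtain ⟨a, b, hab, h0⟩ := hP
  have hlt := hab.2.2.1
  have hb : 0 < b := by linarith
  have ha : a = -b := by linarith
  obtain ⟨ε, hε, H⟩ := exists_shift (R := |R| + 2 * b) (η := b) (by positivity) hb
  refine ⟨ε, hε, fun Q hQ hd => ?_⟩
  obtain ⟨c, d, hcd, h0'⟩ := hQ
  obtain ⟨s, hs, hw⟩ := H P Q hd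
  have hs1 := abs_lt.1 hs
  have hR := abs_nonneg R
  have e1 : Q.next 0 = b - s := by
    refine next_eq ((hw _ ?_).2 ?_) (by linarith) fun w hwQ hw0 => ?_
    · rw [abs_lt]; constructor <;> linarith
    · rw [sub_add_cancel]; exact hab.2.1
    · by_contra hlt'
      have hlt' := not_le.1 hlt'
      exact hab.2.2.2 (w + s) ((hw w (by rw [abs_of_pos hw0]; linarith)).1 hwQ)
        ⟨by linarith, by linarith⟩
  have e2 : Q.prev 0 = a - s := by
    refine prev_eq ((hw _ ?_).2 ?_) (by linarith) fun w hwQ hw0 => ?_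
    · rw [abs_lt]; constructor <;> linarith
    · rw [sub_add_cancel]; exact hab.1
    · by_contra hlt'
      have hlt' := not_le.1 hlt'
      exact hab.2.2.2 (w + s) ((hw w (by rw [abs_of_neg hw0]; linarith)).1 hwQ)
        ⟨by linarith, by linarith⟩
  obtain ⟨e3, e4⟩ := next_prev_of_puncture hcd h0'
  have hs0 : s = 0 := by linarith
  rw [agree_iff]
  intro v hv
  rw [hw v (by linarith [le_abs_self R]), hs0, add_zero]

theorem exists_agree_dist_translate_lt (x : ℝ) {ε : ℝ} (hε : 0 < ε) :
    ∃ R, |x| < R ∧ ∀ P Q : Tiling, Agree R P Q → dist (Q.translate x) (P.translate x) < ε := by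
  refine ⟨|x| + 1 / ε, by linarith [show 0 < 1 / ε by positivity], fun P Q h => ?_⟩
  have h' := h.translate x
  rw [add_sub_cancel_left] at h'
  refine (dist_le_of_agree (by positivity) h'.symm).trans_lt ?_
  rw [div_lt_iff₀ (by positivity), mul_add, mul_one_div_cancel hε.ne']
  linarith

theorem continuous_toNext_of_agree {S : Set Tiling}
    (hS : ∀ P ∈ S, ∀ R, ∃ ε > 0, ∀ Q ∈ S, dist P Q < ε → Agree R P Q) :
    Continuous fun Q : S => (Q : Tiling).toNext := by
  rw [Metric.continuous_iff]
  rintro ⟨P, hP⟩ ε hε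
  obtain ⟨R, hxR, hR⟩ := exists_agree_dist_translate_lt (P.next 0) hε
  obtain ⟨δ, hδ, H⟩ := hS P hP R
  refine ⟨δ, hδ, fun Q hQ => ?_⟩
  have ha := H Q Q.2 (by rwa [dist_comm] at hQ)
  have := hR P Q ha
  rw [toNext, toNext, ha.next_eq ((le_abs_self _).trans_lt hxR)]
  exact this

theorem continuous_toPrev_of_agree {S : Set Tiling}
    (hS : ∀ P ∈ S, ∀ R, ∃ ε > 0, ∀ Q ∈ S, dist P Q < ε → Agree R P Q) :
    Continuous fun Q : S => (Q : Tiling).toPrev := by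
  rw [Metric.continuous_iff]
  rintro ⟨P, hP⟩ ε hε
  obtain ⟨R, hxR, hR⟩ := exists_agree_dist_translate_lt (P.prev 0) hε
  obtain ⟨δ, hδ, H⟩ := hS P hP R
  refine ⟨δ, hδ, fun Q hQ => ?_⟩
  have ha := H Q Q.2 (by rwa [dist_comm] at hQ)
  have := hR P Q ha
  rw [toPrev, toPrev, ha.prev_eq ((neg_le_abs _).trans_lt hxR)]
  exact this

theorem agree_transversal₀ (P : Tiling) : ∀ Q ∈ P.transversal₀, ∀ R, ∃ ε > 0,
    ∀ Q' ∈ P.transversal₀, dist Q Q' < ε → Agree R Q Q' := fun Q _ R =>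
  let ⟨ε, hε, H⟩ := exists_agree_of_vertex Q R
  ⟨ε, hε, fun Q' hQ' => H Q' hQ'.2⟩

theorem agree_transversal₁ (P : Tiling) : ∀ Q ∈ P.transversal₁, ∀ R, ∃ ε > 0,
    ∀ Q' ∈ P.transversal₁, dist Q Q' < ε → Agree R Q Q' := fun _ hQ R =>
  let ⟨ε, hε, H⟩ := exists_agree_of_puncture hQ.2 R
  ⟨ε, hε, fun Q' hQ' => H Q' hQ'.2⟩

/-! ### Weak PV-cohomology -/

/-- The map `Ξ¹ → Ξ⁰` moving the puncture of the tile at `0` to its right vertex. -/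
def rightFace (P : Tiling) : C(P.transversal₁, P.transversal₀) where
  toFun Q := ⟨(Q : Tiling).toNext, toNext_mem Q.2.1⟩
  continuous_toFun := (continuous_toNext_of_agree P.agree_transversal₁).subtype_mk _

/-- The map `Ξ¹ → Ξ⁰` moving the puncture of the tile at `0` to its left vertex. -/
def leftFace (P : Tiling) : C(P.transversal₁, P.transversal₀) where
  toFun Q := ⟨(Q : Tiling).toPrev, toPrev_mem Q.2.1⟩
  continuous_toFun := (continuous_toPrev_of_agree P.agree_transversal₁).subtype_mk _

/-- The PV-differential `C(Ξ⁰, ℝ) → C(Ξ¹, ℝ)`; tiles are oriented from left to right. -/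
def dPV (P : Tiling) : C(P.transversal₀, ℝ) →ₗ[ℝ] C(P.transversal₁, ℝ) where
  toFun f := f.comp P.rightFace - f.comp P.leftFace
  map_add' f g := by
    ext Q
    simp only [ContinuousMap.add_apply, ContinuousMap.sub_apply, ContinuousMap.comp_apply]
    ring
  map_smul' c f := by
    ext Q
    simp only [ContinuousMap.smul_apply, ContinuousMap.sub_apply, ContinuousMap.comp_apply,
      RingHom.id_apply, smul_eq_mul]
    ring

/-- The first weak PV-cohomology with real coefficients. As there are no simplices of dimension
two, every element of `C(Ξ¹, ℝ)` is a cocycle. -/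
abbrev WeakPVH1 (P : Tiling) : Type :=
  C(P.transversal₁, ℝ) ⧸ LinearMap.range P.dPV

/-! ### The first return map and the cohomology of `ℤ` -/

/-- The first return map to `Ξ⁰` of the translation action of `ℝ` on the hull. -/
def returnMap (P : Tiling) : P.transversal₀ ≃ₜ P.transversal₀ where
  toFun Q := ⟨(Q : Tiling).toNext, toNext_mem Q.2.1⟩
  invFun Q := ⟨(Q : Tiling).toPrev, toPrev_mem Q.2.1⟩
  left_inv Q := Subtype.ext (toPrev_toNext Q.2.2)
  right_inv Q := Subtype.ext (toNext_toPrev Q.2.2)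
  continuous_toFun := (continuous_toNext_of_agree P.agree_transversal₀).subtype_mk _
  continuous_invFun := (continuous_toPrev_of_agree P.agree_transversal₀).subtype_mk _

/-- The representation of `ℤ` on `C(Ξ⁰, ℝ)` in which `n` acts by `f ↦ f ∘ φⁿ`, where `φ` is the
first return map. -/
def returnRep (P : Tiling) : Representation ℝ (Multiplicative ℤ) C(P.transversal₀, ℝ) where
  toFun n :=
    { toFun := fun f => f.comp (↑(P.returnMap ^ n.toAdd) : C(P.transversal₀, P.transversal₀))
      map_add' := fun _ _ => rfl
      map_smul' := fun _ _ => rfl }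
  map_one' := by
    ext f Q
    simp
  map_mul' m n := by
    ext f Q
    simp only [toAdd_mul, add_comm (Multiplicative.toAdd m), zpow_add]
    rfl

/-- The first cohomology of the group `ℤ` with coefficients in `C(Ξ⁰, ℝ)`. -/
abbrev ReturnH1 (P : Tiling) : Type :=
  groupCohomology.H1 (Rep.of P.returnRep)

/-! ### Weak pattern equivariant simplicial cohomology -/

/-- The tiles (one-dimensional simplices) of `P`, as pairs (left endpoint, right endpoint). -/
abbrev Tile (P : Tiling) : Type := {t : ℝ × ℝ // P.IsTile t.1 t.2}

/-- The `k`-neighbourhoods of the simplices `[a, b]` and `[a', b']` of `P` (with `a = b`, `a' = b'`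
in the case of vertices), consisting of the simplex and the `k` tiles following it on either side,
agree up to a translation carrying `[a, b]` to `[a', b']`. -/
def SameNeighborhood (P : Tiling) (k : ℕ) (a b a' b' : ℝ) : Prop :=
  b - a = b' - a' ∧ ∀ j ≤ k,
    P.next^[j] b - b = P.next^[j] b' - b' ∧ P.prev^[j] a - a = P.prev^[j] a' - a'

/-- Bounded real `0`-cochains with the supremum norm. -/
abbrev BddCochain₀ (P : Tiling) : Type := lp (fun _ : P.vertices => ℝ) ⊤

/-- Bounded real `1`-cochains with the supremum norm. -/
abbrev BddCochain₁ (P : Tiling) : Type := lp (fun _ : P.Tile => ℝ) ⊤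

/-- Strongly pattern equivariant `0`-cochains: the value on a vertex depends only on its
`k`-neighbourhood, for some `k`. -/
def sPECochain₀ (P : Tiling) : Submodule ℝ P.BddCochain₀ where
  carrier := {c | ∃ k : ℕ, ∀ v w : P.vertices, P.SameNeighborhood k v v w w → c v = c w}
  zero_mem' := ⟨0, fun _ _ _ => rfl⟩
  add_mem' := by
    rintro c d ⟨k, hk⟩ ⟨l, hl⟩
    refine ⟨max k l, fun v w h => ?_⟩
    have h1 := hk v w ⟨h.1, fun j hj => h.2 j (hj.trans (le_max_left _ _))⟩
    have h2 := hl v w ⟨h.1, fun j hj => h.2 j (hj.trans (le_max_right _ _))⟩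
    simp [h1, h2]
  smul_mem' := by
    rintro r c ⟨k, hk⟩
    exact ⟨k, fun v w h => by simp [hk v w h]⟩

/-- Strongly pattern equivariant `1`-cochains. -/
def sPECochain₁ (P : Tiling) : Submodule ℝ P.BddCochain₁ where
  carrier := {c | ∃ k : ℕ, ∀ s t : P.Tile,
    P.SameNeighborhood k s.1.1 s.1.2 t.1.1 t.1.2 → c s = c t}
  zero_mem' := ⟨0, fun _ _ _ => rfl⟩
  add_mem' := by
    rintro c d ⟨k, hk⟩ ⟨l, hl⟩
    refine ⟨max k l, fun v w h => ?_⟩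
    have h1 := hk v w ⟨h.1, fun j hj => h.2 j (hj.trans (le_max_left _ _))⟩
    have h2 := hl v w ⟨h.1, fun j hj => h.2 j (hj.trans (le_max_right _ _))⟩
    simp [h1, h2]
  smul_mem' := by
    rintro r c ⟨k, hk⟩
    exact ⟨k, fun v w h => by simp [hk v w h]⟩

/-- Weakly pattern equivariant `0`-cochains: the uniform closure of the strongly pattern
equivariant ones. -/
def wPECochain₀ (P : Tiling) : Submodule ℝ P.BddCochain₀ := P.sPECochain₀.topologicalClosure

/-- Weakly pattern equivariant `1`-cochains. -/
def wPECochain₁ (P : Tiling) : Submodule ℝ P.BddCochain₁ := P.sPECochain₁.topologicalClosure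

/-- The simplicial coboundary. -/
def dS (P : Tiling) : P.BddCochain₀ →ₗ[ℝ] P.BddCochain₁ where
  toFun c := ⟨fun t => c ⟨t.1.2, t.2.2.1⟩ - c ⟨t.1.1, t.2.1⟩, by
    refine memℓp_infty ⟨‖c‖ + ‖c‖, ?_⟩
    rintro _ ⟨t, rfl⟩
    exact (norm_sub_le _ _).trans
      (add_le_add (lp.norm_apply_le_norm ENNReal.top_ne_zero c _)
        (lp.norm_apply_le_norm ENNReal.top_ne_zero c _))⟩
  map_add' c d := by
    ext t
    simp only [lp.coeFn_add, Pi.add_apply]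
    ring
  map_smul' r c := by
    ext t
    simp only [lp.coeFn_smul, Pi.smul_apply, smul_eq_mul, RingHom.id_apply]
    ring

/-- The first weak pattern equivariant simplicial cohomology with real coefficients. -/
abbrev WeakPESimplicialH1 (P : Tiling) : Type :=
  P.wPECochain₁ ⧸ (P.wPECochain₀.map P.dS).comap P.wPECochain₁.subtype

/-! ### Weak pattern equivariant de Rham cohomology

A one-form `f dx` on `ℝ` is identified with the function `f`, so that the exterior derivative
`d : 𝒜⁰ → 𝒜¹` is the derivative. -/

/-- Smooth functions all of whose derivatives are bounded. -/
def BddSmooth : Submodule ℝ (ℝ → ℝ) where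
  carrier := {f | ContDiff ℝ (⊤ : ℕ∞) f ∧ ∀ k : ℕ, ∃ C : ℝ, ∀ x, |iteratedDeriv k f x| ≤ C}
  zero_mem' := ⟨contDiff_const, fun k => ⟨0, fun x => by
    have h : (0 : ℝ → ℝ) = fun _ => 0 := rfl
    rw [h, iteratedDeriv_const]; simp⟩⟩
  add_mem' := by
    rintro f g ⟨hf, hf'⟩ ⟨hg, hg'⟩
    refine ⟨hf.add hg, fun k => ?_⟩
    obtain ⟨C, hC⟩ := hf' k
    obtain ⟨D, hD⟩ := hg' k
    refine ⟨C + D, fun x => ?_⟩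
    rw [iteratedDeriv_add (hf.contDiffAt.of_le (by exact_mod_cast le_top))
      (hg.contDiffAt.of_le (by exact_mod_cast le_top))]
    exact (abs_add_le _ _).trans (add_le_add (hC x) (hD x))
  smul_mem' := by
    rintro r f ⟨hf, hf'⟩
    refine ⟨contDiff_const.smul hf, fun k => ?_⟩
    obtain ⟨C, hC⟩ := hf' k
    refine ⟨|r| * C, fun x => ?_⟩
    rw [iteratedDeriv_const_smul_field, smul_eq_mul, abs_mul]
    exact mul_le_mul_of_nonneg_left (hC x) (abs_nonneg r)

/-- `f` is pattern equivariant with range `R`. -/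
def IsPE (P : Tiling) (R : ℝ) (f : ℝ → ℝ) : Prop :=
  ∀ x y : ℝ, Agree R (P.translate x) (P.translate y) → f x = f y

/-- Smooth strongly pattern equivariant functions. -/
def sPEForm (P : Tiling) : Submodule ℝ (ℝ → ℝ) where
  carrier := {f | f ∈ BddSmooth ∧ ∃ R > 0, P.IsPE R f}
  zero_mem' := ⟨BddSmooth.zero_mem, 1, one_pos, fun _ _ _ => rfl⟩
  add_mem' := by
    rintro f g ⟨hf, R, hR, hf'⟩ ⟨hg, S, hS, hg'⟩
    refine ⟨BddSmooth.add_mem hf hg, max R S, lt_max_of_lt_left hR, fun x y h => ?_⟩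
    rw [Pi.add_apply, Pi.add_apply, hf' x y (h.mono (le_max_left _ _)),
      hg' x y (h.mono (le_max_right _ _))]
  smul_mem' := by
    rintro r f ⟨hf, R, hR, hf'⟩
    refine ⟨BddSmooth.smul_mem r hf, R, hR, fun x y h => ?_⟩
    rw [Pi.smul_apply, Pi.smul_apply, hf' x y h]

/-- Smooth weakly pattern equivariant functions: the closure of the strongly pattern equivariant
ones with respect to the seminorms `s_k(f) = sup_{j ≤ k} ‖f^{(j)}‖_∞`. -/
def wPEForm (P : Tiling) : Submodule ℝ (ℝ → ℝ) where
  carrier := {f | f ∈ BddSmooth ∧ ∀ k : ℕ, ∀ ε > 0, ∃ g ∈ P.sPEForm,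
    ∀ j ≤ k, ∀ x, |iteratedDeriv j (f - g) x| ≤ ε}
  zero_mem' := ⟨BddSmooth.zero_mem, fun k ε hε => ⟨0, P.sPEForm.zero_mem, fun j _ x => by
    have h : (0 - 0 : ℝ → ℝ) = fun _ => 0 := by ext; simp
    rw [h, iteratedDeriv_const]; simp [hε.le]⟩⟩
  add_mem' := by
    rintro f g ⟨hf, hf'⟩ ⟨hg, hg'⟩
    refine ⟨BddSmooth.add_mem hf hg, fun k ε hε => ?_⟩
    obtain ⟨u, hu, hu'⟩ := hf' k (ε / 2) (by positivity)
    obtain ⟨v, hv, hv'⟩ := hg' k (ε / 2) (by positivity)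
    refine ⟨u + v, P.sPEForm.add_mem hu hv, fun j hj x => ?_⟩
    rw [show f + g - (u + v) = (f - u) + (g - v) by abel,
      iteratedDeriv_add (f := f - u) (g := g - v)
        ((hf.1.sub hu.1.1).contDiffAt.of_le (by exact_mod_cast le_top))
        ((hg.1.sub hv.1.1).contDiffAt.of_le (by exact_mod_cast le_top))]
    exact (abs_add_le _ _).trans (by linarith [hu' j hj x, hv' j hj x])
  smul_mem' := by
    rintro r f ⟨hf, hf'⟩
    refine ⟨BddSmooth.smul_mem r hf, fun k ε hε => ?_⟩
    obtain ⟨u, hu, hu'⟩ := hf' k (ε / (|r| + 1)) (by positivity)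
    refine ⟨r • u, P.sPEForm.smul_mem r hu, fun j hj x => ?_⟩
    rw [← smul_sub, iteratedDeriv_const_smul_field, smul_eq_mul, abs_mul]
    have h := hu' j hj x
    rw [le_div_iff₀ (by positivity)] at h
    nlinarith [abs_nonneg (iteratedDeriv j (f - u) x)]

/-- The weakly exact one-forms `d g`, `g ∈ 𝒜⁰_w`. -/
def wExact (P : Tiling) : Submodule ℝ P.wPEForm where
  carrier := {f | ∃ g ∈ P.wPEForm, deriv g = (f : ℝ → ℝ)}
  zero_mem' := ⟨0, P.wPEForm.zero_mem, by
    ext x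
    exact deriv_const x (0 : ℝ)⟩
  add_mem' := by
    rintro f g ⟨u, hu, hu'⟩ ⟨v, hv, hv'⟩
    refine ⟨u + v, P.wPEForm.add_mem hu hv, ?_⟩
    ext x
    rw [deriv_add ((hu.1.1.differentiable (by simp)).differentiableAt)
      ((hv.1.1.differentiable (by simp)).differentiableAt), hu', hv']
    rfl
  smul_mem' := by
    rintro r f ⟨u, hu, hu'⟩
    refine ⟨r • u, P.wPEForm.smul_mem r hu, ?_⟩
    ext x
    rw [deriv_const_smul r ((hu.1.1.differentiable (by simp)).differentiableAt), hu']
    rfl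

/-- The first weak pattern equivariant de Rham cohomology. -/
abbrev WeakPEdeRhamH1 (P : Tiling) : Type := P.wPEForm ⧸ P.wExact

end Tiling

/-! ### Cut and project tilings of dimension and codimension one

`E` is the line of slope `θ` in `ℝ²`, with unit direction vector `(1, θ) / √(1 + θ²)`; its
orthocomplement has unit direction vector `(-θ, 1) / √(1 + θ²)`. Both lines are identified with `ℝ`
by means of these vectors. -/

/-- The orthogonal projection of the lattice point `(m, n)` to `E`. -/
def projPar (θ : ℝ) (m n : ℤ) : ℝ := (m + n * θ) / √(1 + θ ^ 2)

/-- The orthogonal projection of the lattice point `(m, n)` to the orthocomplement of `E`. -/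
def projPerp (θ : ℝ) (m n : ℤ) : ℝ := (n - m * θ) / √(1 + θ ^ 2)

/-- The projections to `E` of the lattice points in the strip `K + E`. -/
def cutProjectSet (θ : ℝ) (K : Set ℝ) : Set ℝ :=
  {v | ∃ m n : ℤ, projPerp θ m n ∈ K ∧ v = projPar θ m n}

theorem cutProjectSet_finite (θ : ℝ) {K : Set ℝ} (hK : IsCompact K) (r : ℝ) :
    (cutProjectSet θ K ∩ Set.Icc (-r) r).Finite := by
  obtain ⟨M, hM⟩ := hK.isBounded.exists_norm_le
  have hs : 0 < √(1 + θ ^ 2) := Real.sqrt_pos.2 (by positivity)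
  have hss : √(1 + θ ^ 2) * √(1 + θ ^ 2) = 1 + θ ^ 2 := Real.mul_self_sqrt (by positivity)
  obtain ⟨B, hB⟩ := exists_nat_ge ((1 + |θ|) * (|r| + |M|))
  have hfin : ((Set.Icc (-(B : ℤ)) B) ×ˢ (Set.Icc (-(B : ℤ)) B)).Finite :=
    (Set.finite_Icc _ _).prod (Set.finite_Icc _ _)
  refine (hfin.image fun p => projPar θ p.1 p.2).subset ?_
  rintro _ ⟨⟨m, n, hmn, rfl⟩, h1, h2⟩
  refine ⟨(m, n), ?_, rfl⟩
  set s := √(1 + θ ^ 2) with hsdef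
  set u := projPar θ m n with hu
  set w := projPerp θ m n with hw
  have hu' : u * s = m + n * θ := by rw [hu, projPar, div_mul_cancel₀ _ hs.ne']
  have hw' : w * s = n - m * θ := by rw [hw, projPerp, div_mul_cancel₀ _ hs.ne']
  have hua : |u| ≤ |r| := (abs_le.2 ⟨h1, h2⟩).trans (le_abs_self r)
  have hwa : |w| ≤ |M| := (hM w hmn).trans (le_abs_self M)
  have hm : (m : ℝ) * s = u - θ * w := by
    have : ((m : ℝ) * s - (u - θ * w)) * s = 0 := by linear_combination m * hss - hu' + θ * hw'
    rcases mul_eq_zero.1 this with h | h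
    · linarith
    · exact absurd h hs.ne'
  have hn : (n : ℝ) * s = θ * u + w := by
    have : ((n : ℝ) * s - (θ * u + w)) * s = 0 := by linear_combination n * hss - θ * hu' - hw'
    rcases mul_eq_zero.1 this with h | h
    · linarith
    · exact absurd h hs.ne'
  have hs1 : 1 ≤ s := Real.one_le_sqrt.2 (by nlinarith [sq_nonneg θ])
  have e1 : |u - θ * w| ≤ B := by
    refine le_trans ((abs_sub _ _).trans ?_) hB
    rw [abs_mul]
    nlinarith [abs_nonneg θ, abs_nonneg r, abs_nonneg M,
      mul_le_mul_of_nonneg_left hwa (abs_nonneg θ)]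
  have e2 : |θ * u + w| ≤ B := by
    refine le_trans ((abs_add_le _ _).trans ?_) hB
    rw [abs_mul]
    nlinarith [abs_nonneg θ, abs_nonneg r, abs_nonneg M,
      mul_le_mul_of_nonneg_left hua (abs_nonneg θ)]
  have em : |(m : ℝ)| ≤ B := by
    rw [← hm, abs_mul, abs_of_pos hs] at e1
    nlinarith [abs_nonneg (m : ℝ)]
  have en : |(n : ℝ)| ≤ B := by
    rw [← hn, abs_mul, abs_of_pos hs] at e2
    nlinarith [abs_nonneg (n : ℝ)]
  rw [abs_le] at em en
  exact ⟨⟨by exact_mod_cast em.1, by exact_mod_cast em.2⟩,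
    ⟨by exact_mod_cast en.1, by exact_mod_cast en.2⟩⟩

/-- There are lattice points close to `E` whose projection to `E` is arbitrarily large. -/
theorem exists_projPar_gt (θ : ℝ) {δ : ℝ} (hδ : 0 < δ) (r : ℝ) :
    ∃ m n : ℤ, |projPerp θ m n| < δ ∧ r < projPar θ m n := by
  have hs : 0 < √(1 + θ ^ 2) := Real.sqrt_pos.2 (by positivity)
  set s := √(1 + θ ^ 2) with hsdef
  obtain ⟨i, hi⟩ := exists_nat_gt (4 * (|r| * s) + 1)
  have hi0 : (0 : ℝ) < i := lt_trans (by positivity) hi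
  obtain ⟨N, hN⟩ := exists_nat_gt (i / (δ * s))
  have hN0 : (0 : ℝ) < N := lt_trans (by positivity) hN
  obtain ⟨j, k, hk0, -, hjk⟩ := Real.exists_int_int_abs_mul_sub_le θ
    (n := N) (by exact_mod_cast hN0)
  have hk1 : (1 : ℝ) ≤ k := by exact_mod_cast hk0
  have hle : (1 : ℝ) / (N + 1) ≤ 1 := by rw [div_le_one (by positivity)]; linarith
  refine ⟨i * k, i * j, ?_, ?_⟩
  · rw [projPerp, abs_div, abs_of_pos hs, div_lt_iff₀ hs]
    push_cast
    rw [show (i : ℝ) * j - i * k * θ = -(i * (k * θ - j)) by ring, abs_neg, abs_mul,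
      abs_of_pos hi0]
    rw [div_lt_iff₀ (by positivity)] at hN
    calc (i : ℝ) * |k * θ - j| ≤ i * (1 / (N + 1)) := mul_le_mul_of_nonneg_left hjk hi0.le
      _ = i / (N + 1) := by ring
      _ < δ * s := by
        rw [div_lt_iff₀ (by positivity)]
        nlinarith [mul_pos hδ hs]
  · rw [projPar, lt_div_iff₀ hs]
    push_cast
    have h1 : k * (1 + θ ^ 2) - |θ| ≤ k + j * θ := by
      have h2 : |(k * θ - j) * θ| ≤ |θ| := by
        rw [abs_mul]
        nlinarith [abs_nonneg θ]
      have := le_abs_self ((k * θ - j) * θ)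
      nlinarith
    have h3 : 1 / 4 ≤ (k : ℝ) + j * θ := by
      have : |θ| ^ 2 = θ ^ 2 := sq_abs θ
      nlinarith [sq_nonneg (|θ| - 1 / 2), sq_nonneg θ]
    have h4 : r * s ≤ |r| * s := mul_le_mul_of_nonneg_right (le_abs_self r) hs.le
    nlinarith

theorem projPar_add (θ : ℝ) (m n p q : ℤ) :
    projPar θ (m + p) (n + q) = projPar θ m n + projPar θ p q := by
  simp only [projPar]; push_cast; ring

theorem projPerp_add (θ : ℝ) (m n p q : ℤ) :
    projPerp θ (m + p) (n + q) = projPerp θ m n + projPerp θ p q := by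
  simp only [projPerp]; push_cast; ring

theorem projPar_neg (θ : ℝ) (m n : ℤ) : projPar θ (-m) (-n) = -projPar θ m n := by
  simp only [projPar]; push_cast; ring

theorem projPerp_neg (θ : ℝ) (m n : ℤ) : projPerp θ (-m) (-n) = -projPerp θ m n := by
  simp only [projPerp]; push_cast; ring

theorem exists_projPerp_near {θ : ℝ} (hθ : Irrational θ) (x : ℝ) {δ : ℝ} (hδ : 0 < δ) :
    ∃ m n : ℤ, |projPerp θ m n - x| < δ := by
  have hs : 0 < √(1 + θ ^ 2) := Real.sqrt_pos.2 (by positivity)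
  have hd : Dense (AddSubgroup.closure {θ, 1} : Set ℝ) :=
    dense_addSubgroupClosure_pair_iff.2 (by simpa using hθ)
  obtain ⟨y, hy, hyd⟩ := Metric.dense_iff.1 hd (x * √(1 + θ ^ 2)) (δ * √(1 + θ ^ 2)) (by positivity)
  obtain ⟨a, b, rfl⟩ := AddSubgroup.mem_closure_pair.1 hyd
  refine ⟨-a, b, ?_⟩
  rw [Metric.mem_ball, Real.dist_eq] at hy
  have e : projPerp θ (-a) b - x = (a • θ + b • (1 : ℝ) - x * √(1 + θ ^ 2)) / √(1 + θ ^ 2) := by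
    simp only [projPerp, zsmul_eq_mul]
    field_simp
    push_cast
    ring
  rw [e, abs_div, abs_of_pos hs, div_lt_iff₀ hs]
  exact hy

theorem exists_cutProject {θ : ℝ} (hθ : Irrational θ) {K : Set ℝ} (hreg : closure (interior K) = K)
    (hne : K.Nonempty) : ∃ m n : ℤ, ∃ δ > 0, ∀ p q : ℤ, |projPerp θ p q| < δ →
      projPerp θ (m + p) (n + q) ∈ K := by
  have hint : (interior K).Nonempty := by
    rw [← hreg] at hne; exact closure_nonempty_iff.1 hne
  obtain ⟨x, hx⟩ := hint
  obtain ⟨δ, hδ, hsub⟩ := Metric.isOpen_iff.1 isOpen_interior x hx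
  obtain ⟨m, n, hmn⟩ := exists_projPerp_near hθ x (half_pos hδ)
  refine ⟨m, n, δ / 2, half_pos hδ, fun p q h => interior_subset (hsub ?_)⟩
  rw [Metric.mem_ball, Real.dist_eq, projPerp_add]
  calc |projPerp θ m n + projPerp θ p q - x|
      = |(projPerp θ m n - x) + projPerp θ p q| := by ring_nf
    _ ≤ _ := abs_add_le _ _
    _ < δ := by linarith

/-- The cut and project tiling with slope `θ` and acceptance window `K`: the endpoints of its tiles
are the projections to `E` of the lattice points in `K + E`. -/
def cutProjectTiling (θ : ℝ) (hθ : Irrational θ) (K : Set ℝ) (hK : IsCompact K)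
    (hreg : closure (interior K) = K) (hne : K.Nonempty) : Tiling where
  vertices := cutProjectSet θ K
  finite_inter := cutProjectSet_finite θ hK
  unbounded_above r := by
    obtain ⟨m, n, δ, hδ, h⟩ := exists_cutProject hθ hreg hne
    obtain ⟨p, q, hpq, hr⟩ := exists_projPar_gt θ hδ (r - projPar θ m n)
    exact ⟨_, ⟨m + p, n + q, h p q hpq, rfl⟩, by rw [projPar_add]; linarith⟩
  unbounded_below r := by
    obtain ⟨m, n, δ, hδ, h⟩ := exists_cutProject hθ hreg hne
    obtain ⟨p, q, hpq, hr⟩ := exists_projPar_gt θ hδ (projPar θ m n - r)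
    refine ⟨_, ⟨m + -p, n + -q, h _ _ (by rw [projPerp_neg, abs_neg]; exact hpq), rfl⟩, ?_⟩
    rw [projPar_add, projPar_neg]
    linarith

end TilingCohomology

end

namespace TilingCohomology

/-! ### Quotients of finite dimension -/

/-! Each of the four spaces is controlled by the cokernel of a difference operator `T f = f ∘ φ -
f`, where `φ` moves from one vertex to the next. Suppose that a bounded operator `T` between Banach
spaces has a cokernel of finite dimension. Adjoining a finite-dimensional complement of the range
makes it surjective, so the open mapping theorem yields a constant `C` such that every `T f` equals
`T g` for some `g` of norm at most `C * ‖T f‖` (`exists_preimage_norm_le_of_finite_quotient`).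

Aperiodicity contradicts this estimate. For each `n` some pattern around a vertex does not recur at
the next `2n + 1` vertices. Letting the indicator function of this pattern decay with slope `1/n`
along orbits (`tent`) gives a function `f` that takes the values `1` and `0` on a single orbit, with
`‖T f‖ ≤ 1/n`. If `T g = T f`, then `g - f` is constant along that orbit, so `g` also varies by `1`
there and `‖g‖ ≥ 1/2`; this is impossible when `C/n < 1/2`.

The argument is run twice: on `C(Ξ⁰, ℝ)` for the first return map
(`not_finite_quotient_returnDiff`), where finite local complexity and bounded gaps make `Ξ⁰`
compact, and on weakly pattern equivariant cochains (`not_finite_weakPESimplicialH1`). The other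
spaces need only one-sided comparisons, not isomorphisms. Pulling back along the left endpoint of a
tile compares coinvariants with PV-cohomology, and evaluating cocycles at the generator maps `H¹(ℤ,
-)` onto coinvariants. Placing a bump of mass `c t` in each tile `t` turns cochains into forms, and
integration over tiles undoes this.

For a cut and project tiling, vertex differences lie in the cut and project set of the compact
window `K - K`. Bounded gaps follow from lattice points on both sides of `E` close to it. A non-zero
period would move the perpendicular coordinate out of the bounded window. -/

theorem finite_quotient_of_comap_le {A B : Type*} [AddCommGroup A] [Module ℝ A] [AddCommGroup B]
    [Module ℝ B] (L : A →ₗ[ℝ] B) {M : Submodule ℝ A} {N : Submodule ℝ B} (h : N.comap L ≤ M)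
    (hN : Module.Finite ℝ (B ⧸ N)) : Module.Finite ℝ (A ⧸ M) := by
  -- `A ⧸ L⁻¹(N)` embeds in `B ⧸ N`, and `A ⧸ M` is a quotient of it.
  have hinj : Function.Injective (Submodule.mapQ (N.comap L) N L le_rfl) := by
    rw [← LinearMap.ker_eq_bot, Submodule.ker_mapQ, Submodule.mkQ_map_self]
  have := Module.Finite.of_injective _ hinj
  exact Module.Finite.of_surjective (Submodule.factor h) (Submodule.factor_surjective h)

/-- If the range of a bounded operator between Banach spaces has finite codimension, then every
element of the range has a preimage of comparable norm. -/
theorem exists_preimage_norm_le_of_finite_quotient {V W : Type*} [NormedAddCommGroup V]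
    [NormedSpace ℝ V] [CompleteSpace V] [NormedAddCommGroup W] [NormedSpace ℝ W] [CompleteSpace W]
    (T : V →L[ℝ] W) (h : Module.Finite ℝ (W ⧸ LinearMap.range (T : V →ₗ[ℝ] W))) :
    ∃ C > 0, ∀ v, ∃ v', T v' = T v ∧ ‖v'‖ ≤ C * ‖T v‖ := by
  obtain ⟨F, hF⟩ := Submodule.exists_isCompl (LinearMap.range (T : V →ₗ[ℝ] W))
  have hfin : FiniteDimensional ℝ F :=
    LinearEquiv.finiteDimensional (Submodule.quotientEquivOfIsCompl _ F hF)
  have : CompleteSpace F := FiniteDimensional.complete ℝ F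
  -- The complement `F` fills the missing finite-dimensional part of `W`, so that the open mapping
  -- theorem applies to `S`.
  set S : V × F →L[ℝ] W := T.coprod F.subtypeL with hS
  have hsurj : Function.Surjective S := by
    intro w
    have hw : w ∈ LinearMap.range (T : V →ₗ[ℝ] W) ⊔ F := by rw [hF.sup_eq_top]; trivial
    obtain ⟨_, ⟨v, rfl⟩, f, hf, rfl⟩ := Submodule.mem_sup.1 hw
    exact ⟨(v, ⟨f, hf⟩), rfl⟩
  obtain ⟨C, hC, H⟩ := S.exists_preimage_norm_le hsurj
  refine ⟨C, hC, fun v => ?_⟩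
  obtain ⟨⟨v', f⟩, hvf, hle⟩ := H (T v)
  have e : T v' + f = T v := hvf
  -- The component in `F` is a difference of two elements of the range, hence lies in the trivial
  -- intersection.
  have hf : (f : W) = 0 := by
    refine (Submodule.disjoint_def.1 hF.disjoint) f ⟨v - v', ?_⟩ f.2
    simp [← e]
  rw [hf, add_zero] at e
  exact ⟨v', e, (norm_fst_le (v', f)).trans hle⟩

/-! ### Slowly varying functions on a dynamical system -/

section Tent

variable {X : Type*} (φ : X → X) (u : X → ℝ) (n : ℕ)

/-- The function decreasing linearly from `u` along the orbits of `φ` in both directions, with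
slope `1 / n`, shifted by `n` iterations. -/
noncomputable def tent (x : X) : ℝ :=
  (Finset.range (2 * n + 1)).sup' ⟨0, by simp⟩ fun i => u (φ^[i] x) - |(i : ℝ) - n| / n

variable {φ u n}

theorem le_tent {i : ℕ} (hi : i ≤ 2 * n) (x : X) :
    u (φ^[i] x) - |(i : ℝ) - n| / n ≤ tent φ u n x :=
  Finset.le_sup' (fun i : ℕ => u (φ^[i] x) - |(i : ℝ) - n| / n) (by simpa [Nat.lt_succ_iff] using hi)

theorem tent_le {x : X} {r : ℝ} (h : ∀ i ≤ 2 * n, u (φ^[i] x) - |(i : ℝ) - n| / n ≤ r) :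
    tent φ u n x ≤ r :=
  Finset.sup'_le _ _ fun i hi => h i (by simpa [Nat.lt_succ_iff] using hi)

/-- Only the values of `u` at the first `2n + 1` points of the orbit enter, so a tent over a locally
determined function is again locally determined. -/
theorem tent_congr {Y : Type*} {ψ : Y → Y} {w : Y → ℝ} {x : X} {y : Y}
    (h : ∀ i ≤ 2 * n, u (φ^[i] x) = w (ψ^[i] y)) : tent φ u n x = tent ψ w n y :=
  le_antisymm (tent_le fun i hi => by rw [h i hi]; exact le_tent hi y)
    (tent_le fun i hi => by rw [← h i hi]; exact le_tent hi x)

theorem apply_iterate_le_tent (x : X) : u (φ^[n] x) ≤ tent φ u n x := by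
  simpa using le_tent (φ := φ) (u := u) (n := n) (i := n) (by omega) x

theorem tent_nonneg (h0 : ∀ x, 0 ≤ u x) (x : X) : 0 ≤ tent φ u n x :=
  (h0 _).trans (apply_iterate_le_tent x)

theorem tent_le_one (h1 : ∀ x, u x ≤ 1) (x : X) : tent φ u n x ≤ 1 :=
  tent_le fun i _ => by
    have : 0 ≤ |(i : ℝ) - n| / n := by positivity
    linarith [h1 (φ^[i] x)]

theorem tent_eq_one (h1 : ∀ x, u x ≤ 1) {x : X} (hx : u (φ^[n] x) = 1) : tent φ u n x = 1 :=
  le_antisymm (tent_le_one h1 x) (hx ▸ apply_iterate_le_tent x)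

theorem tent_eq_zero (h0 : ∀ x, 0 ≤ u x) {x : X} (hx : ∀ i ≤ 2 * n, u (φ^[i] x) = 0) :
    tent φ u n x = 0 :=
  le_antisymm (tent_le fun i hi => by
    have : 0 ≤ |(i : ℝ) - n| / n := by positivity
    linarith [hx i hi]) (tent_nonneg h0 x)

/-- Passing from `x` to `φ x` shifts the index by one and so changes the penalty by at most `1 / n`.
The one index left without a counterpart is an end of the range, where the penalty is `1`; its term
is at most `0`, while the tent is non-negative. -/
theorem abs_tent_apply_sub_le (h0 : ∀ x, 0 ≤ u x) (h1 : ∀ x, u x ≤ 1) (hn : 0 < n) (x : X) :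
    |tent φ u n (φ x) - tent φ u n x| ≤ 1 / n := by
  have hn' : (0 : ℝ) < n := by exact_mod_cast hn
  have hpos : 0 < 1 / (n : ℝ) := by positivity
  have key : ∀ i j : ℕ, (i : ℝ) = j + 1 →
      |(i : ℝ) - n| / n ≤ |(j : ℝ) - n| / n + 1 / n ∧
      |(j : ℝ) - n| / n ≤ |(i : ℝ) - n| / n + 1 / n := by
    intro i j hij
    rw [← add_div, ← add_div, div_le_div_iff_of_pos_right hn', div_le_div_iff_of_pos_right hn']
    have h := abs_abs_sub_abs_le ((i : ℝ) - n) (j - n)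
    rw [show (i : ℝ) - n - (j - n) = 1 by rw [hij]; ring, abs_one, abs_le] at h
    constructor <;> linarith [h.1, h.2]
  rw [abs_sub_le_iff, sub_le_iff_le_add, sub_le_iff_le_add]
  constructor
  · refine tent_le fun i hi => ?_
    rcases hi.lt_or_eq with hi | rfl
    · have := le_tent (φ := φ) (u := u) (n := n) (i := i + 1) (by omega) x
      rw [Function.iterate_succ_apply] at this
      linarith [(key (i + 1) i (by push_cast; ring)).1]
    · have e : |((2 * n : ℕ) : ℝ) - n| / n = 1 := by
        push_cast
        rw [show 2 * (n : ℝ) - n = n by ring, abs_of_pos hn', div_self hn'.ne']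
      rw [e]
      linarith [h1 (φ^[2 * n] (φ x)), tent_nonneg (φ := φ) (n := n) h0 x]
  · refine tent_le fun i hi => ?_
    rcases i with _ | i
    · have e : |((0 : ℕ) : ℝ) - n| / n = 1 := by
        rw [Nat.cast_zero, zero_sub, abs_neg, abs_of_pos hn', div_self hn'.ne']
      rw [e]
      linarith [h1 (φ^[0] x), tent_nonneg (φ := φ) (n := n) h0 (φ x)]
    · have := le_tent (φ := φ) (u := u) (n := n) (i := i) (by omega) (φ x)
      rw [Function.iterate_succ_apply]
      linarith [(key (i + 1) i (by push_cast; ring)).2]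

theorem continuous_tent [TopologicalSpace X] (hφ : Continuous φ) (hu : Continuous u) :
    Continuous (tent φ u n) :=
  Continuous.finset_sup'_apply _ fun i _ => (hu.comp (hφ.iterate i)).sub continuous_const

end Tent

namespace Tiling

/-! ### Finite local complexity, bounded gaps and aperiodicity -/

/-- The set of differences of vertices is locally finite (finite local complexity). -/
def FiniteDifferences (P : Tiling) : Prop :=
  ∀ r : ℝ, ({x | ∃ v ∈ P.vertices, ∃ w ∈ P.vertices, x = v - w} ∩ Set.Icc (-r) r).Finite

/-- The lengths of the tiles are bounded by `L`. -/
def GapLE (P : Tiling) (L : ℝ) : Prop := ∀ x, P.next x ≤ x + L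

/-- `P` has no non-trivial period. -/
def Aperiodic (P : Tiling) : Prop := ∀ x, P.translate x = P → x = 0

theorem next_le {P : Tiling} {x v : ℝ} (hv : v ∈ P.vertices) (h : x < v) : P.next x ≤ v :=
  (P.isLeast_next x).2 ⟨hv, h⟩

theorem le_prev {P : Tiling} {x v : ℝ} (hv : v ∈ P.vertices) (h : v < x) : v ≤ P.prev x :=
  (P.isGreatest_prev x).2 ⟨hv, h⟩

theorem GapLE.pos {P : Tiling} {L : ℝ} (h : P.GapLE L) : 0 < L := by
  linarith [h 0, P.lt_next 0]

theorem GapLE.sub_le_prev {P : Tiling} {L : ℝ} (h : P.GapLE L) (x : ℝ) : x - L ≤ P.prev x := by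
  by_contra hlt
  have h1 := not_le.1 hlt
  have h2 : P.next (P.prev x) < x := by linarith [h (P.prev x)]
  linarith [le_prev (P.next_mem _) h2, P.lt_next (P.prev x)]

theorem next_iterate_mem {P : Tiling} {v : ℝ} (hv : v ∈ P.vertices) (i : ℕ) :
    P.next^[i] v ∈ P.vertices := by
  cases i with
  | zero => exact hv
  | succ i => rw [Function.iterate_succ_apply']; exact P.next_mem _

theorem prev_iterate_mem {P : Tiling} {v : ℝ} (hv : v ∈ P.vertices) (i : ℕ) :
    P.prev^[i] v ∈ P.vertices := by
  cases i with
  | zero => exact hv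
  | succ i => rw [Function.iterate_succ_apply']; exact P.prev_mem _

theorem lt_next_iterate (P : Tiling) (v : ℝ) {i : ℕ} (hi : 0 < i) : v < P.next^[i] v := by
  induction i, hi using Nat.le_induction with
  | base => exact P.lt_next v
  | succ i _ ih => rw [Function.iterate_succ_apply']; exact ih.trans (P.lt_next _)

theorem toNext_translate {P : Tiling} (v : ℝ) : (P.translate v).toNext = P.translate (P.next v) := by
  rw [toNext, next_translate, translate_translate, zero_add]
  ring_nf

theorem toNext_iterate_translate {P : Tiling} (v : ℝ) (i : ℕ) :
    toNext^[i] (P.translate v) = P.translate (P.next^[i] v) := by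
  induction i with
  | zero => rfl
  | succ i ih => rw [Function.iterate_succ_apply', ih, toNext_translate, Function.iterate_succ_apply']

theorem translate_mem_transversal₀ {P : Tiling} {v : ℝ} (hv : v ∈ P.vertices) :
    P.translate v ∈ P.transversal₀ :=
  ⟨subset_closure ⟨v, rfl⟩, by rwa [mem_translate, zero_add]⟩

theorem eq_of_forall_agree {P Q : Tiling} (h : ∀ R, Agree R P Q) : P = Q := by
  ext v
  exact agree_iff.1 (h (|v| + 1)) v (by linarith)

theorem Agree.trans {R : ℝ} {P Q S : Tiling} (h : Agree R P Q) (h' : Agree R Q S) : Agree R P S :=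
  Eq.trans h h'

/-- Agreement at every radius would make two distinct translates equal and so produce a period. Only
finitely many `i` are involved, so the maximum of their radii serves them all. -/
theorem Aperiodic.exists_not_agree {P : Tiling} (hP : P.Aperiodic) (v : ℝ) (N : ℕ) :
    ∃ R, ∀ i, 0 < i → i ≤ N → ¬ Agree R (P.translate (P.next^[i] v)) (P.translate v) := by
  induction N with
  | zero => exact ⟨0, fun i h h' => by omega⟩
  | succ N ih =>
    obtain ⟨R, hR⟩ := ih
    have : ∃ S, ¬ Agree S (P.translate (P.next^[N + 1] v)) (P.translate v) := by
      by_contra! h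
      have e := congrArg (translate (-v)) (eq_of_forall_agree h)
      rw [translate_translate, translate_translate, add_neg_cancel, translate_zero] at e
      linarith [hP _ e, P.lt_next_iterate v N.succ_pos]
    obtain ⟨S, hS⟩ := this
    refine ⟨max R S, fun i hi hi' h => ?_⟩
    rcases hi'.lt_or_eq with hlt | rfl
    · exact hR i hi (by omega) (h.mono (le_max_left _ _))
    · exact hS (h.mono (le_max_right _ _))

/-! ### Neighbourhoods of simplices -/

theorem SameNeighborhood.mono {P : Tiling} {k l : ℕ} {a b a' b' : ℝ}
    (h : P.SameNeighborhood l a b a' b') (hkl : k ≤ l) : P.SameNeighborhood k a b a' b' :=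
  ⟨h.1, fun j hj => h.2 j (hj.trans hkl)⟩

theorem SameNeighborhood.symm {P : Tiling} {k : ℕ} {a b a' b' : ℝ}
    (h : P.SameNeighborhood k a b a' b') : P.SameNeighborhood k a' b' a b :=
  ⟨h.1.symm, fun j hj => ⟨(h.2 j hj).1.symm, (h.2 j hj).2.symm⟩⟩

theorem SameNeighborhood.trans {P : Tiling} {k : ℕ} {a b a' b' a'' b'' : ℝ}
    (h : P.SameNeighborhood k a b a' b') (h' : P.SameNeighborhood k a' b' a'' b'') :
    P.SameNeighborhood k a b a'' b'' :=
  ⟨h.1.trans h'.1, fun j hj => ⟨(h.2 j hj).1.trans (h'.2 j hj).1, (h.2 j hj).2.trans (h'.2 j hj).2⟩⟩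

/-- Moving one vertex to the right uses up one tile of the known neighbourhood on that side, hence
`k + 1` in the hypothesis. -/
theorem SameNeighborhood.next {P : Tiling} {k : ℕ} {v w : ℝ} (hv : v ∈ P.vertices)
    (hw : w ∈ P.vertices) (h : P.SameNeighborhood (k + 1) v v w w) :
    P.SameNeighborhood k (P.next v) (P.next v) (P.next w) (P.next w) := by
  refine ⟨by simp, fun j hj => ?_⟩
  have h1 := (h.2 1 (by omega)).1
  simp only [Function.iterate_one] at h1
  constructor
  · have h2 := (h.2 (j + 1) (by omega)).1
    rw [Function.iterate_succ_apply, Function.iterate_succ_apply] at h2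
    linarith
  · rcases j with _ | j
    · simp
    · have h2 := (h.2 j (by omega)).2
      rw [Function.iterate_succ_apply, Function.iterate_succ_apply, prev_next hv, prev_next hw]
      linarith

theorem SameNeighborhood.next_iterate {P : Tiling} {k : ℕ} {v w : ℝ} (hv : v ∈ P.vertices)
    (hw : w ∈ P.vertices) (i : ℕ) (h : P.SameNeighborhood (k + i) v v w w) :
    P.SameNeighborhood k (P.next^[i] v) (P.next^[i] v) (P.next^[i] w) (P.next^[i] w) := by
  induction i generalizing v w with
  | zero => exact h
  | succ i ih => exact ih (P.next_mem _) (P.next_mem _) (SameNeighborhood.next hv hw h)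

theorem IsTile.next_eq {P : Tiling} {a b : ℝ} (h : P.IsTile a b) : P.next a = b :=
  Tiling.next_eq h.2.1 h.2.2.1 fun w hw hlt => not_lt.1 fun hwb => h.2.2.2 w hw ⟨hlt, hwb⟩

theorem IsTile.prev_eq {P : Tiling} {a b : ℝ} (h : P.IsTile a b) : P.prev b = a :=
  Tiling.prev_eq h.1 h.2.2.1 fun w hw hlt => not_lt.1 fun hwb => h.2.2.2 w hw ⟨hwb, hlt⟩

/-- No loss in `k` here: the tile itself is the first tile to the right of its left endpoint.
Together with the analogue for the right endpoint this makes the coboundary preserve the range of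
pattern equivariance. -/
theorem SameNeighborhood.left {P : Tiling} {k : ℕ} {a b a' b' : ℝ} (hab : P.IsTile a b)
    (hab' : P.IsTile a' b') (h : P.SameNeighborhood k a b a' b') :
    P.SameNeighborhood k a a a' a' := by
  refine ⟨by simp, fun j hj => ⟨?_, (h.2 j hj).2⟩⟩
  rcases j with _ | j
  · simp
  · rw [Function.iterate_succ_apply, Function.iterate_succ_apply, hab.next_eq, hab'.next_eq]
    linarith [(h.2 j (by omega)).1, h.1]

theorem SameNeighborhood.right {P : Tiling} {k : ℕ} {a b a' b' : ℝ} (hab : P.IsTile a b)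
    (hab' : P.IsTile a' b') (h : P.SameNeighborhood k a b a' b') :
    P.SameNeighborhood k b b b' b' := by
  refine ⟨by simp, fun j hj => ⟨(h.2 j hj).1, ?_⟩⟩
  rcases j with _ | j
  · simp
  · rw [Function.iterate_succ_apply, Function.iterate_succ_apply, hab.prev_eq, hab'.prev_eq]
    linarith [(h.2 j (by omega)).2, h.1]

theorem exists_next_iterate_eq {P : Tiling} {v x : ℝ} (hx : x ∈ P.vertices)
    (hvx : v ≤ x) (k : ℕ) (hk : x ≤ P.next^[k] v) : ∃ j ≤ k, P.next^[j] v = x := by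
  induction k with
  | zero => exact ⟨0, le_rfl, le_antisymm hvx hk⟩
  | succ k ih =>
    by_cases h : x ≤ P.next^[k] v
    · obtain ⟨j, hj, e⟩ := ih h
      exact ⟨j, by omega, e⟩
    · refine ⟨k + 1, le_rfl, le_antisymm ?_ hk⟩
      rw [Function.iterate_succ_apply']
      exact next_le hx (not_le.1 h)

theorem exists_prev_iterate_eq {P : Tiling} {v x : ℝ} (hx : x ∈ P.vertices)
    (hvx : x ≤ v) (k : ℕ) (hk : P.prev^[k] v ≤ x) : ∃ j ≤ k, P.prev^[j] v = x := by
  induction k with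
  | zero => exact ⟨0, le_rfl, le_antisymm hk hvx⟩
  | succ k ih =>
    by_cases h : P.prev^[k] v ≤ x
    · obtain ⟨j, hj, e⟩ := ih h
      exact ⟨j, by omega, e⟩
    · refine ⟨k + 1, le_rfl, le_antisymm hk ?_⟩
      rw [Function.iterate_succ_apply']
      exact le_prev hx (not_le.1 h)

/-- Only finitely many positive differences of vertices are at most `1`, so they have a positive
minimum. -/
theorem FiniteDifferences.exists_gap {P : Tiling} (hP : P.FiniteDifferences) :
    ∃ m > 0, ∀ v ∈ P.vertices, ∀ w ∈ P.vertices, v < w → v + m ≤ w := by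
  have hfin : ({x | ∃ v ∈ P.vertices, ∃ w ∈ P.vertices, x = v - w} ∩ Set.Icc (-1) 1 ∩
    Set.Ioi 0).Finite := (hP 1).inter_of_left _
  obtain ⟨m, hm, H⟩ : ∃ m > 0, ∀ x ∈ ({x | ∃ v ∈ P.vertices, ∃ w ∈ P.vertices, x = v - w} ∩
      Set.Icc (-1) 1 ∩ Set.Ioi (0 : ℝ)), m ≤ x := by
    rcases Set.eq_empty_or_nonempty ({x | ∃ v ∈ P.vertices, ∃ w ∈ P.vertices, x = v - w} ∩
      Set.Icc (-1) 1 ∩ Set.Ioi (0 : ℝ)) with h | h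
    · exact ⟨1, one_pos, by simp [h]⟩
    · obtain ⟨m, hm, hmin⟩ := Set.exists_min_image _ id hfin h
      exact ⟨m, hm.2, hmin⟩
  refine ⟨min m 1, by positivity, fun v hv w hw hvw => ?_⟩
  by_cases h1 : w - v ≤ 1
  · have := H (w - v) ⟨⟨⟨w, hw, v, hv, rfl⟩, by linarith, h1⟩, sub_pos.2 hvw⟩
    linarith [min_le_left m 1]
  · linarith [min_le_right m 1]

theorem next_iterate_ge {P : Tiling} {m : ℝ}
    (hm : ∀ v ∈ P.vertices, ∀ w ∈ P.vertices, v < w → v + m ≤ w) {v : ℝ} (hv : v ∈ P.vertices)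
    (k : ℕ) : v + k * m ≤ P.next^[k] v := by
  induction k with
  | zero => simp
  | succ k ih =>
    rw [Function.iterate_succ_apply']
    have := hm _ (next_iterate_mem hv k) _ (P.next_mem _) (P.lt_next (P.next^[k] v))
    push_cast
    linarith

theorem prev_iterate_le {P : Tiling} {m : ℝ}
    (hm : ∀ v ∈ P.vertices, ∀ w ∈ P.vertices, v < w → v + m ≤ w) {v : ℝ} (hv : v ∈ P.vertices)
    (k : ℕ) : P.prev^[k] v ≤ v - k * m := by
  induction k with
  | zero => simp
  | succ k ih =>
    rw [Function.iterate_succ_apply']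
    have := hm _ (P.prev_mem _) _ (prev_iterate_mem hv k) (P.prev_lt (P.prev^[k] v))
    push_cast
    linarith

theorem FiniteDifferences.exists_agree_of_sameNeighborhood {P : Tiling}
    (hP : P.FiniteDifferences) (R : ℝ) : ∃ k : ℕ, ∀ v ∈ P.vertices, ∀ w ∈ P.vertices,
      P.SameNeighborhood k v v w w → Agree R (P.translate v) (P.translate w) := by
  obtain ⟨m, hm0, hm⟩ := hP.exists_gap
  obtain ⟨k, hk⟩ := exists_nat_gt (R / m)
  -- Tiles have length at least `m`, so `k > R / m` of them on either side reach beyond the ball of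
  -- radius `R`.
  rw [div_lt_iff₀ hm0] at hk
  have key : ∀ v ∈ P.vertices, ∀ w ∈ P.vertices, P.SameNeighborhood k v v w w →
      ∀ x, |x| < R → x + v ∈ P.vertices → x + w ∈ P.vertices := by
    intro v hv w hw h x hx hxv
    have hx' := abs_lt.1 hx
    rcases le_total 0 x with h0 | h0
    · obtain ⟨j, hj, e⟩ := exists_next_iterate_eq (v := v) hxv (by linarith) k
        (by linarith [next_iterate_ge hm hv k])
      have : x + w = P.next^[j] w := by linarith [(h.2 j hj).1]
      rw [this]
      exact next_iterate_mem hw j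
    · obtain ⟨j, hj, e⟩ := exists_prev_iterate_eq (v := v) hxv (by linarith) k
        (by linarith [prev_iterate_le hm hv k])
      have : x + w = P.prev^[j] w := by linarith [(h.2 j hj).2]
      rw [this]
      exact prev_iterate_mem hw j
  exact ⟨k, fun v hv w hw h => agree_iff.2 fun x hx =>
    ⟨key v hv w hw h x hx, key w hw v hv h.symm x hx⟩⟩

/-! ### Compactness of the transversal -/

/-- An orbit point close to `Q` coincides with `Q` on a large ball up to a shift, and the vertex of
`Q` at `0` forces the total translation to be a vertex of `P`. Local properties of `P` thus pass to
all of `Ξ⁰`. -/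
theorem exists_agree_translate {P Q : Tiling} (hQ : Q ∈ P.transversal₀) (R : ℝ) :
    ∃ v ∈ P.vertices, Agree R Q (P.translate v) := by
  obtain ⟨ε, hε, H⟩ := exists_shift (R := |R| + 1) (η := 1) (by positivity) one_pos
  obtain ⟨_, ⟨x, rfl⟩, hd⟩ := Metric.mem_closure_iff.1 hQ.1 ε hε
  obtain ⟨s, -, hw⟩ := H (P.translate x) Q (by rwa [dist_comm])
  refine ⟨s + x, ?_, agree_iff.2 fun v hv => ?_⟩
  · simpa [mem_translate] using (hw 0 (by rw [abs_zero]; positivity)).1 hQ.2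
  · rw [hw v (by linarith [le_abs_self R]), mem_translate, mem_translate, add_assoc]

theorem GapLE.of_mem_transversal₀ {P Q : Tiling} {L : ℝ} (h : P.GapLE L)
    (hQ : Q ∈ P.transversal₀) : Q.GapLE L := by
  intro x
  have hL := h.pos
  obtain ⟨v, hv, ha⟩ := exists_agree_translate hQ (|x| + L + 1)
  have h1 := (P.translate v).lt_next x
  have h2 : (P.translate v).next x ≤ x + L := by
    rw [next_translate]; linarith [h (x + v)]
  refine (next_le ((agree_iff.1 ha _ ?_).2 ((P.translate v).next_mem x)) h1).trans h2
  rw [abs_lt]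
  constructor <;> linarith [neg_abs_le x, le_abs_self x]

theorem mem_differences_of_mem_transversal₀ {P Q : Tiling} (hQ : Q ∈ P.transversal₀) {x : ℝ}
    (hx : x ∈ Q.vertices) : ∃ v ∈ P.vertices, ∃ w ∈ P.vertices, x = v - w := by
  obtain ⟨v, hv, ha⟩ := exists_agree_translate hQ (|x| + 1)
  exact ⟨x + v, (agree_iff.1 ha x (by linarith)).1 hx, v, hv, by ring⟩

/-- Within any ball there are only finitely many possible vertices, so an ultrafilter decides each
of them. The vertices it accepts form the limit tiling. Compactness is what makes `C(Ξ⁰, ℝ)` a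
Banach space under the supremum norm. -/
theorem compactSpace_transversal₀ {P : Tiling} (hP : P.FiniteDifferences) {L : ℝ}
    (hL : P.GapLE L) : CompactSpace P.transversal₀ := by
  rw [← isCompact_iff_compactSpace, isCompact_iff_ultrafilter_le_nhds]
  intro 𝒰 hU
  have hU : ∀ᶠ Q in (𝒰 : Filter Tiling), Q ∈ P.transversal₀ := Filter.le_principal_iff.1 hU
  set S : Set ℝ := {v | ∀ᶠ Q in (𝒰 : Filter Tiling), v ∈ Q.vertices} with hS
  have hfin : ∀ r, (S ∩ Set.Icc (-r) r).Finite := fun r => by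
    refine (hP r).subset ?_
    rintro v ⟨hv, hr⟩
    obtain ⟨Q, hQ, hvQ⟩ := (hU.and hv).exists
    exact ⟨mem_differences_of_mem_transversal₀ hQ hvQ, hr⟩
  have hex : ∀ x, ∃ v ∈ S, x < v ∧ v ≤ x + L := by
    intro x
    have hf : ({y | ∃ v ∈ P.vertices, ∃ w ∈ P.vertices, y = v - w} ∩ Set.Ioc x (x + L)).Finite := by
      refine (hP (|x| + L)).subset ?_
      rintro y ⟨hy, h1, h2⟩
      exact ⟨hy, by linarith [neg_abs_le x, hL.pos], by linarith [le_abs_self x]⟩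
    -- Every tiling in `Ξ⁰` has its next vertex after `x` in one finite set, so the ultrafilter
    -- selects an element of it. This keeps the limit set unbounded in both directions.
    have := (Ultrafilter.eventually_exists_mem_iff (f := 𝒰)
      (P := fun v (Q : Tiling) => v ∈ Q.vertices) hf).1
      (hU.mono fun Q hQ => ⟨Q.next x, ⟨mem_differences_of_mem_transversal₀ hQ (Q.next_mem x),
        Q.lt_next x, hL.of_mem_transversal₀ hQ x⟩, Q.next_mem x⟩)
    obtain ⟨v, ⟨-, h⟩, hv⟩ := this
    exact ⟨v, hv, h⟩
  let Q₀ : Tiling :=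
    { vertices := S
      finite_inter := hfin
      unbounded_above := fun r => (hex r).imp fun v hv => ⟨hv.1, hv.2.1⟩
      unbounded_below := fun r => (hex (r - L - 1)).imp fun v hv => ⟨hv.1, by linarith [hv.2.2]⟩ }
  have h0 : (0 : ℝ) ∈ Q₀.vertices := hU.mono fun Q hQ => hQ.2
  have hag : ∀ R, ∀ᶠ Q in (𝒰 : Filter Tiling), Agree R Q Q₀ := by
    intro R
    -- Each of the finitely many candidate points is decided separately, and the finite intersection
    -- still belongs to the ultrafilter.
    have : ∀ᶠ Q in (𝒰 : Filter Tiling), ∀ v ∈ {x | ∃ v ∈ P.vertices, ∃ w ∈ P.vertices, x = v - w} ∩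
        Set.Icc (-R) R, (v ∈ Q.vertices ↔ v ∈ S) := by
      rw [Filter.eventually_all_finite (hP R)]
      intro v _
      by_cases hv : v ∈ S
      · exact Filter.Eventually.mono hv fun Q hQ => iff_of_true hQ hv
      · exact (Ultrafilter.eventually_not.2 hv).mono fun Q hQ => iff_of_false hQ hv
    filter_upwards [this, hU] with Q hQ hQU
    rw [agree_iff]
    intro v hv
    have hv' := abs_lt.1 hv
    have hIcc : v ∈ Set.Icc (-R) R := ⟨hv'.1.le, hv'.2.le⟩
    constructor
    · intro h
      exact (hQ v ⟨mem_differences_of_mem_transversal₀ hQU h, hIcc⟩).1 h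
    · intro h
      obtain ⟨Q', hQ', hvQ'⟩ := (hU.and h).exists
      exact (hQ v ⟨mem_differences_of_mem_transversal₀ hQ' hvQ', hIcc⟩).2 h
  have hle : (𝒰 : Filter Tiling) ≤ nhds Q₀ := by
    rw [Metric.nhds_basis_ball.ge_iff]
    intro ε hε
    filter_upwards [hag (1 / ε)] with Q hQ
    rw [Metric.mem_ball]
    refine (dist_le_of_agree (by positivity) hQ).trans_lt ?_
    rw [div_lt_iff₀ (by positivity), mul_add, mul_one_div_cancel hε.ne']
    linarith
  refine ⟨Q₀, ⟨?_, h0⟩, hle⟩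
  exact isClosed_closure.mem_of_tendsto (f := id) hle (hU.mono fun Q hQ => hQ.1)

/-! ### Coinvariants of the first return map -/

/-- The operator `f ↦ f ∘ φ - f` on `C(Ξ⁰, ℝ)`, where `φ` is the first return map. -/
noncomputable def returnDiff (P : Tiling) : C(P.transversal₀, ℝ) →L[ℝ] C(P.transversal₀, ℝ) where
  toFun f := f.comp (P.returnMap : C(P.transversal₀, P.transversal₀)) - f
  map_add' f g := by
    ext Q
    simp only [ContinuousMap.add_apply, ContinuousMap.sub_apply, ContinuousMap.comp_apply]
    ring
  map_smul' c f := by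
    ext Q
    simp only [ContinuousMap.smul_apply, ContinuousMap.sub_apply, ContinuousMap.comp_apply,
      RingHom.id_apply, smul_eq_mul]
    ring
  cont := (ContinuousMap.continuous_precomp _).sub continuous_id

theorem returnDiff_apply {P : Tiling} (f : C(P.transversal₀, ℝ)) (Q : P.transversal₀) :
    P.returnDiff f Q = f (P.returnMap Q) - f Q := rfl

theorem coe_returnMap_iterate {P : Tiling} (Q : P.transversal₀) (i : ℕ) :
    ((P.returnMap^[i] Q : P.transversal₀) : Tiling) = toNext^[i] (Q : Tiling) := by
  induction i with
  | zero => rfl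
  | succ i ih => rw [Function.iterate_succ_apply', Function.iterate_succ_apply', ← ih]; rfl

open Classical in
/-- The indicator function of the tilings in `Ξ⁰` coinciding with `S` on the ball of radius `R`. -/
noncomputable def patternIndicator (P : Tiling) (R : ℝ) (S : Tiling) (Q : P.transversal₀) : ℝ :=
  if Agree R Q S then 1 else 0

/-- Sufficiently close tilings of `Ξ⁰` agree exactly on a given ball, because both have a vertex at
`0`; the indicator is therefore locally constant. -/
theorem continuous_patternIndicator (P : Tiling) (R : ℝ) (S : Tiling) :
    Continuous (P.patternIndicator R S) := by
  refine IsLocallyConstant.continuous ((IsLocallyConstant.iff_eventually_eq _).2 fun Q => ?_)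
  obtain ⟨ε, hε, H⟩ := P.agree_transversal₀ Q Q.2 R
  filter_upwards [Metric.ball_mem_nhds Q hε] with Q' hQ'
  have h := H Q' Q'.2 (by rw [dist_comm]; exact hQ')
  have : Agree R Q' S ↔ Agree R Q S := ⟨h.trans, h.symm.trans⟩
  by_cases hS : Agree R Q S
  · rw [patternIndicator, patternIndicator, if_pos hS, if_pos (this.2 hS)]
  · rw [patternIndicator, patternIndicator, if_neg hS, if_neg (mt this.1 hS)]

theorem patternIndicator_nonneg (P : Tiling) (R : ℝ) (S : Tiling) (Q : P.transversal₀) :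
    0 ≤ P.patternIndicator R S Q := by
  rw [patternIndicator]; split_ifs <;> norm_num

theorem patternIndicator_le_one (P : Tiling) (R : ℝ) (S : Tiling) (Q : P.transversal₀) :
    P.patternIndicator R S Q ≤ 1 := by
  rw [patternIndicator]; split_ifs <;> norm_num

/-- A single orbit suffices: a tent with tiny coboundary but variation `1` along it has no primitive
of comparably small norm. -/
theorem not_finite_quotient_returnDiff {P : Tiling} [CompactSpace P.transversal₀]
    (hP : P.Aperiodic) :
    ¬ Module.Finite ℝ (C(P.transversal₀, ℝ) ⧸
      LinearMap.range (P.returnDiff : C(P.transversal₀, ℝ) →ₗ[ℝ] C(P.transversal₀, ℝ))) := by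
  intro hfin
  obtain ⟨C, hC, H⟩ := exists_preimage_norm_le_of_finite_quotient _ hfin
  obtain ⟨n, hn⟩ := exists_nat_gt (2 * C)
  have hn0 : (0 : ℝ) < n := lt_trans (by positivity) hn
  have ha := P.next_mem 0
  set a := P.next 0
  -- The pattern is centred `n` vertices after `a` because the tent carries no penalty at the `n`-th
  -- iterate; its value `1` is thus attained at `z`.
  obtain ⟨R, hR⟩ := hP.exists_not_agree (P.next^[n] a) (2 * n + 1)
  set S := P.translate (P.next^[n] a)
  let z : P.transversal₀ := ⟨P.translate a, translate_mem_transversal₀ ha⟩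
  have hz : ∀ i, ((P.returnMap^[i] z : P.transversal₀) : Tiling) = P.translate (P.next^[i] a) :=
    fun i => by rw [coe_returnMap_iterate, toNext_iterate_translate]
  let f : C(P.transversal₀, ℝ) := ⟨tent P.returnMap (P.patternIndicator R S) n,
    continuous_tent P.returnMap.continuous (P.continuous_patternIndicator R S)⟩
  have h0 := P.patternIndicator_nonneg R S
  have h1 := P.patternIndicator_le_one R S
  have f1 : f z = 1 := by
    refine tent_eq_one h1 ?_
    rw [patternIndicator, if_pos]
    rw [hz]
    rfl
  -- The tent at this point inspects the iterates `n + 1, …, 3n + 1` of `z`, that is, the positions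
  -- `1, …, 2n + 1` after the centre, where the pattern does not recur.
  have f0 : f (P.returnMap^[n + 1] z) = 0 := by
    refine tent_eq_zero h0 fun i hi => ?_
    rw [patternIndicator, if_neg]
    rw [← Function.iterate_add_apply, hz, show i + (n + 1) = (i + 1) + n by ring,
      Function.iterate_add_apply]
    exact hR (i + 1) (by omega) (by omega)
  have hsmall : ‖P.returnDiff f‖ ≤ 1 / n :=
    (ContinuousMap.norm_le _ (by positivity)).2 fun Q =>
      abs_tent_apply_sub_le h0 h1 (by exact_mod_cast hn0) Q
  obtain ⟨g, hg, hle⟩ := H f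
  -- Equal coboundaries force `g - f` to be constant along the orbit of `z`.
  have hinv : ∀ i, g (P.returnMap^[i] z) - f (P.returnMap^[i] z) = g z - f z := by
    intro i
    induction i with
    | zero => rfl
    | succ i ih =>
      have := DFunLike.congr_fun hg (P.returnMap^[i] z)
      rw [returnDiff_apply, returnDiff_apply] at this
      rw [Function.iterate_succ_apply', ← ih]
      linarith
  have e := hinv (n + 1)
  have b1 := abs_le.1 (g.norm_coe_le_norm z)
  have b2 := abs_le.1 (g.norm_coe_le_norm (P.returnMap^[n + 1] z))
  -- The values of `g` at the two points differ by `1`, yet both would have absolute value below `1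
  -- / 2`.
  have : C * ‖P.returnDiff f‖ < 1 / 2 := by
    calc C * ‖P.returnDiff f‖ ≤ C * (1 / n) := by gcongr
      _ < 1 / 2 := by rw [mul_one_div, div_lt_div_iff₀ hn0 two_pos]; linarith
  linarith

/-! ### Weak PV-cohomology -/

/-- Translating by half the length of the tile that starts at `0` moves its midpoint to the origin.
-/
theorem leftFace_surjective (P : Tiling) : Function.Surjective P.leftFace := by
  intro Q
  have hn := (Q : Tiling).lt_next 0
  set b := (Q : Tiling).next 0 with hb
  have e : (Q : Tiling).prev (b / 2) = 0 := by
    refine prev_eq Q.2.2 (by linarith) fun w hw hlt => ?_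
    by_contra h
    linarith [next_le hw (not_le.1 h)]
  refine ⟨⟨(Q : Tiling).translate (b / 2), translate_mem_hull Q.2.1 _, -(b / 2), b / 2,
    ⟨?_, ?_, by linarith, ?_⟩, by ring⟩, Subtype.ext ?_⟩
  · rw [mem_translate, neg_add_cancel]; exact Q.2.2
  · rw [mem_translate, add_halves]; exact (Q : Tiling).next_mem 0
  · rintro c hc ⟨h1, h2⟩
    linarith [next_le (mem_translate.1 hc) (show 0 < c + b / 2 by linarith)]
  · change ((Q : Tiling).translate (b / 2)).translate _ = Q
    rw [prev_translate, translate_translate, zero_add, e, zero_sub, add_neg_cancel, translate_zero]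

theorem returnMap_leftFace {P : Tiling} (Q : P.transversal₁) :
    P.returnMap (P.leftFace Q) = P.rightFace Q := by
  obtain ⟨a, b, hab, h0⟩ := Q.2.2
  obtain ⟨hb, ha⟩ := next_prev_of_puncture hab h0
  refine Subtype.ext ?_
  change ((Q : Tiling).translate ((Q : Tiling).prev 0)).toNext =
    (Q : Tiling).translate ((Q : Tiling).next 0)
  rw [toNext_translate, hb, ha]
  congr 1
  exact hab.next_eq

/-- By `returnMap_leftFace`, the PV-differential is the difference operator of the return map
followed by pullback along `leftFace`; surjectivity of `leftFace` allows this pullback to be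
cancelled. -/
theorem not_finite_weakPVH1 {P : Tiling} [CompactSpace P.transversal₀] (hP : P.Aperiodic) :
    ¬ Module.Finite ℝ P.WeakPVH1 := by
  intro hfin
  let L : C(P.transversal₀, ℝ) →ₗ[ℝ] C(P.transversal₁, ℝ) :=
    { toFun := fun f => f.comp P.leftFace
      map_add' := fun _ _ => rfl
      map_smul' := fun _ _ => rfl }
  refine not_finite_quotient_returnDiff hP (finite_quotient_of_comap_le L ?_ hfin)
  rintro f ⟨g, hg⟩
  refine ⟨g, ContinuousMap.ext fun Q => ?_⟩
  obtain ⟨Q, rfl⟩ := P.leftFace_surjective Q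
  have h : g (P.rightFace Q) - g (P.leftFace Q) = f (P.leftFace Q) := DFunLike.congr_fun hg Q
  rw [← returnMap_leftFace] at h
  exact h

end Tiling

/-! ### Cohomology of the integers -/

open groupCohomology in
/-- Every vector is the value at the generator of a one-cocycle of `ℤ`. -/
theorem exists_cocycle_apply_generator {V : Type} [AddCommGroup V] [Module ℝ V]
    (ρ : Representation ℝ (Multiplicative ℤ) V) (x : V) :
    ∃ c : cocycles₁ (Rep.of ρ), c (Multiplicative.ofAdd 1) = x := by
  let e : V ≃ₗ[ℝ] V := LinearEquiv.ofLinearMap (ρ (Multiplicative.ofAdd 1))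
    (ρ (Multiplicative.ofAdd (-1)))
    (by rw [← Module.End.mul_eq_comp, ← map_mul, ← ofAdd_add]; simp; rfl)
    (by rw [← Module.End.mul_eq_comp, ← map_mul, ← ofAdd_add]; simp; rfl)
  -- The affine automorphism `v ↦ ρ(1) v + x`. The orbit `n ↦ Sⁿ 0` is the desired cocycle: the
  -- cocycle identity is `S^(m + n) = S^m ∘ S^n` evaluated at `0`, and invertibility takes care of
  -- negative `n`.
  let S : V ≃ᵃ[ℝ] V := e.toAffineEquiv.trans (AffineEquiv.constVAdd ℝ V x)
  have hlin : ∀ (n : ℤ) (v : V), (S ^ n).linear v = ρ (Multiplicative.ofAdd n) v := by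
    -- The linear part of `Sⁿ` is multiplicative in `n`, so it suffices to compare it with `ρ` at
    -- the generator.
    have h : ρ = LinearEquiv.automorphismGroup.toLinearMapMonoidHom.comp
        ((AffineEquiv.linearHom (k := ℝ) (P₁ := V)).comp (zpowersHom _ S)) := by
      refine MonoidHom.ext_mint (LinearMap.ext fun v => ?_)
      change _ = (S ^ (1 : ℤ)).linear v
      rw [zpow_one]
      rfl
    intro n v
    rw [h]
    rfl
  refine ⟨⟨fun g => (S ^ g.toAdd) 0, (mem_cocycles₁_iff _).2 fun g h => ?_⟩, ?_⟩
  · have := (S ^ g.toAdd).map_vadd 0 ((S ^ h.toAdd) 0)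
    rw [hlin, vadd_eq_add, add_zero] at this
    rw [toAdd_mul, zpow_add]
    exact this
  · change (S ^ (1 : ℤ)) 0 = x
    simp [S, e]

namespace Tiling

open groupCohomology in
-- Evaluation at the generator maps cocycles onto all of `C(Ξ⁰, ℝ)` and sends coboundaries into the
-- range of `returnDiff`, so the coinvariants are a quotient of `H¹`.
theorem not_finite_returnH1 {P : Tiling} [CompactSpace P.transversal₀] (hP : P.Aperiodic) :
    ¬ Module.Finite ℝ P.ReturnH1 := by
  intro hfin
  let ev : cocycles₁ (Rep.of P.returnRep) →ₗ[ℝ] C(P.transversal₀, ℝ) ⧸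
      LinearMap.range (P.returnDiff : C(P.transversal₀, ℝ) →ₗ[ℝ] C(P.transversal₀, ℝ)) :=
    (Submodule.mkQ _) ∘ₗ (LinearMap.proj (Multiplicative.ofAdd (1 : ℤ))) ∘ₗ
      (cocycles₁ (Rep.of P.returnRep)).subtype
  have hsurj : Function.Surjective ev := by
    intro y
    obtain ⟨f, rfl⟩ := Submodule.mkQ_surjective _ y
    obtain ⟨c, hc⟩ := exists_cocycle_apply_generator P.returnRep f
    exact ⟨c, congrArg (Submodule.mkQ _) hc⟩
  have hπ : Function.Surjective (H1π (Rep.of P.returnRep)).hom :=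
    (ModuleCat.epi_iff_surjective _).1 inferInstance
  have hker : LinearMap.ker (H1π (Rep.of P.returnRep)).hom ≤ LinearMap.ker ev := by
    intro c hc
    obtain ⟨f, hf⟩ := (H1π_eq_zero_iff c).1 hc
    have h1 := congrFun hf (Multiplicative.ofAdd (1 : ℤ))
    rw [d₀₁_hom_apply] at h1
    refine (Submodule.Quotient.mk_eq_zero _).2 ⟨f, ?_⟩
    refine Eq.trans (ContinuousMap.ext fun Q => ?_) h1
    change f (P.returnMap Q) - f Q = f ((P.returnMap ^ (1 : ℤ)) Q) - f Q
    rw [zpow_one]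
  refine not_finite_quotient_returnDiff hP ?_
  have := Module.Finite.of_surjective
    (((H1π (Rep.of P.returnRep)).hom.quotKerEquivOfSurjective hπ).symm.toLinearMap)
    (LinearEquiv.surjective _)
  refine Module.Finite.of_surjective
    ((LinearMap.ker (H1π (Rep.of P.returnRep)).hom).liftQ ev hker) ?_
  rw [← LinearMap.range_eq_top, Submodule.range_liftQ, LinearMap.range_eq_top]
  exact hsurj

/-! ### Weak pattern equivariant simplicial cohomology -/

theorem isTile_next {P : Tiling} {v : ℝ} (hv : v ∈ P.vertices) : P.IsTile v (P.next v) :=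
  ⟨hv, P.next_mem v, P.lt_next v, fun _ hc h => (next_le hc h.1).not_gt h.2⟩

/-- The vertex following `v`. -/
noncomputable def nextVertex (P : Tiling) (v : P.vertices) : P.vertices := ⟨P.next v, P.next_mem v⟩

theorem coe_nextVertex_iterate {P : Tiling} (v : P.vertices) (i : ℕ) :
    ((P.nextVertex^[i] v : P.vertices) : ℝ) = P.next^[i] v := by
  induction i with
  | zero => rfl
  | succ i ih => rw [Function.iterate_succ_apply', Function.iterate_succ_apply', ← ih]; rfl

/-- The tile with left endpoint `v`. -/
noncomputable def tileAt (P : Tiling) (v : P.vertices) : P.Tile := ⟨(v, P.next v), isTile_next v.2⟩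

theorem dS_tileAt {P : Tiling} (c : P.BddCochain₀) (v : P.vertices) :
    P.dS c (P.tileAt v) = c (P.nextVertex v) - c v := rfl

theorem exists_eq_tileAt {P : Tiling} (t : P.Tile) : ∃ v, t = P.tileAt v := by
  obtain ⟨⟨a, b⟩, h⟩ := t
  exact ⟨⟨a, h.1⟩, Subtype.ext (Prod.ext rfl h.next_eq.symm)⟩

/-- The simplicial coboundary as a bounded operator. -/
noncomputable def dSL (P : Tiling) : P.BddCochain₀ →L[ℝ] P.BddCochain₁ :=
  P.dS.mkContinuous 2 fun c => by
    refine lp.norm_le_of_forall_le (by positivity) fun t => ?_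
    have h1 := lp.norm_apply_le_norm ENNReal.top_ne_zero c ⟨t.1.2, t.2.2.1⟩
    have h2 := lp.norm_apply_le_norm ENNReal.top_ne_zero c ⟨t.1.1, t.2.1⟩
    exact (norm_sub_le _ _).trans (by linarith)

/-- The coboundary is bounded and preserves strong pattern equivariance with the same `k`, so it
passes to the uniform closures. -/
theorem dS_mem_wPECochain₁ {P : Tiling} {c : P.BddCochain₀} (hc : c ∈ P.wPECochain₀) :
    P.dS c ∈ P.wPECochain₁ := by
  refine map_mem_closure P.dSL.continuous hc ?_
  rintro d ⟨k, hk⟩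
  refine ⟨k, fun s t h => ?_⟩
  exact congrArg₂ (· - ·) (hk ⟨s.1.2, s.2.2.1⟩ ⟨t.1.2, t.2.2.1⟩ (h.right s.2 t.2))
    (hk ⟨s.1.1, s.2.1⟩ ⟨t.1.1, t.2.1⟩ (h.left s.2 t.2))

/-- The simplicial coboundary on weakly pattern equivariant cochains. -/
noncomputable def dSw (P : Tiling) : P.wPECochain₀ →L[ℝ] P.wPECochain₁ :=
  (P.dSL.comp P.wPECochain₀.subtypeL).codRestrict _ fun c => dS_mem_wPECochain₁ c.2

open Classical in
/-- The indicator function of the vertices with the same `k`-neighbourhood as `a`. -/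
noncomputable def vertexIndicator (P : Tiling) (k : ℕ) (a : ℝ) (v : P.vertices) : ℝ :=
  if P.SameNeighborhood k v v a a then 1 else 0

theorem vertexIndicator_nonneg (P : Tiling) (k : ℕ) (a : ℝ) (v : P.vertices) :
    0 ≤ P.vertexIndicator k a v := by
  rw [vertexIndicator]; split_ifs <;> norm_num

theorem vertexIndicator_le_one (P : Tiling) (k : ℕ) (a : ℝ) (v : P.vertices) :
    P.vertexIndicator k a v ≤ 1 := by
  rw [vertexIndicator]; split_ifs <;> norm_num

theorem vertexIndicator_congr {P : Tiling} {k : ℕ} (a : ℝ) {v w : P.vertices}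
    (h : P.SameNeighborhood k v v w w) : P.vertexIndicator k a v = P.vertexIndicator k a w := by
  by_cases hw : P.SameNeighborhood k w w a a
  · rw [vertexIndicator, vertexIndicator, if_pos hw, if_pos (h.trans hw)]
  · rw [vertexIndicator, vertexIndicator, if_neg hw, if_neg (mt h.symm.trans hw)]

/-- The tent argument again, now along the vertices of `P` itself. The cochain spaces are complete
as closed subspaces of `ℓ^∞`, so the hull plays no role. -/
theorem not_finite_weakPESimplicialH1 {P : Tiling} (hfd : P.FiniteDifferences)
    (hP : P.Aperiodic) : ¬ Module.Finite ℝ P.WeakPESimplicialH1 := by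
  intro hfin
  have hcl₀ : IsClosed (P.wPECochain₀ : Set P.BddCochain₀) :=
    Submodule.isClosed_topologicalClosure _
  have hcl₁ : IsClosed (P.wPECochain₁ : Set P.BddCochain₁) :=
    Submodule.isClosed_topologicalClosure _
  have := hcl₀.completeSpace_coe
  have := hcl₁.completeSpace_coe
  have hrange : (P.wPECochain₀.map P.dS).comap P.wPECochain₁.subtype =
      LinearMap.range (P.dSw : P.wPECochain₀ →ₗ[ℝ] P.wPECochain₁) := by
    ext c
    constructor
    · rintro ⟨d, hd, e⟩
      exact ⟨⟨d, hd⟩, Subtype.ext e⟩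
    · rintro ⟨d, rfl⟩
      exact ⟨d, d.2, rfl⟩
  have hfin : Module.Finite ℝ
      (P.wPECochain₁ ⧸ (P.wPECochain₀.map P.dS).comap P.wPECochain₁.subtype) := hfin
  rw [hrange] at hfin
  obtain ⟨C, hC, H⟩ := exists_preimage_norm_le_of_finite_quotient _ hfin
  obtain ⟨n, hn⟩ := exists_nat_gt (2 * C)
  have hn0 : (0 : ℝ) < n := lt_trans (by positivity) hn
  let z : P.vertices := ⟨P.next 0, P.next_mem 0⟩
  set a := P.next^[n] z with ha
  obtain ⟨R, hR⟩ := hP.exists_not_agree a (2 * n + 1)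
  obtain ⟨k, hk⟩ := hfd.exists_agree_of_sameNeighborhood R
  have h0 := P.vertexIndicator_nonneg k a
  have h1 := P.vertexIndicator_le_one k a
  let c : P.BddCochain₀ := ⟨tent P.nextVertex (P.vertexIndicator k a) n, by
    refine memℓp_infty ⟨1, ?_⟩
    rintro _ ⟨v, rfl⟩
    exact (abs_of_nonneg (tent_nonneg h0 v)).trans_le (tent_le_one h1 v)⟩
  -- The tent looks up to `2n` vertices to the right, and the indicator at each of them needs `k`
  -- tiles; hence the range `k + 2n`.
  have hc : c ∈ P.wPECochain₀ := by
    refine Submodule.le_topologicalClosure _ ⟨k + 2 * n, fun v w h => ?_⟩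
    refine tent_congr fun i hi => vertexIndicator_congr a ?_
    rw [coe_nextVertex_iterate, coe_nextVertex_iterate]
    exact SameNeighborhood.next_iterate v.2 w.2 i (h.mono (by omega))
  have c1 : c z = 1 := by
    refine tent_eq_one h1 ?_
    rw [vertexIndicator, if_pos]
    rw [coe_nextVertex_iterate]
    exact ⟨rfl, fun _ _ => ⟨rfl, rfl⟩⟩
  have c0 : c (P.nextVertex^[n + 1] z) = 0 := by
    refine tent_eq_zero h0 fun i hi => ?_
    rw [vertexIndicator, if_neg]
    rw [← Function.iterate_add_apply, coe_nextVertex_iterate, show i + (n + 1) = (i + 1) + n by ring,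
      Function.iterate_add_apply, ← ha]
    exact fun h => hR (i + 1) (by omega) (by omega)
      (hk _ (next_iterate_mem (next_iterate_mem z.2 n) _) _ (next_iterate_mem z.2 n) h)
  have hsmall : ‖P.dSw ⟨c, hc⟩‖ ≤ 1 / n := by
    refine lp.norm_le_of_forall_le (f := P.dS c) (by positivity) fun t => ?_
    obtain ⟨v, rfl⟩ := exists_eq_tileAt t
    rw [dS_tileAt]
    exact abs_tent_apply_sub_le h0 h1 (by exact_mod_cast hn0) v
  obtain ⟨⟨g, hgw⟩, hg, hle⟩ := H ⟨c, hc⟩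
  have hg : P.dS g = P.dS c := congrArg Subtype.val hg
  have hle : ‖g‖ ≤ C * ‖P.dSw ⟨c, hc⟩‖ := hle
  have hinv : ∀ i, g (P.nextVertex^[i] z) - c (P.nextVertex^[i] z) = g z - c z := by
    intro i
    induction i with
    | zero => rfl
    | succ i ih =>
      have := congrArg (fun d : P.BddCochain₁ => d (P.tileAt (P.nextVertex^[i] z))) hg
      simp only [dS_tileAt] at this
      rw [Function.iterate_succ_apply', ← ih]
      linarith
  have e := hinv (n + 1)
  have b1 := abs_le.1 (lp.norm_apply_le_norm ENNReal.top_ne_zero g z)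
  have b2 := abs_le.1 (lp.norm_apply_le_norm ENNReal.top_ne_zero g (P.nextVertex^[n + 1] z))
  have : C * ‖P.dSw ⟨c, hc⟩‖ < 1 / 2 := by
    calc C * ‖P.dSw ⟨c, hc⟩‖ ≤ C * (1 / n) := by gcongr
      _ < 1 / 2 := by rw [mul_one_div, div_lt_div_iff₀ hn0 two_pos]; linarith
  linarith

/-! ### Local dependence of neighbouring vertices -/

theorem Agree.next_eq_of_mem {R : ℝ} {P Q : Tiling} (h : Agree R P Q) {x : ℝ} (hx : -R ≤ x)
    (hn : P.next x < R) : Q.next x = P.next x := by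
  rw [agree_iff] at h
  have h0 := P.lt_next x
  refine Tiling.next_eq ((h _ (abs_lt.2 ⟨by linarith, hn⟩)).1 (P.next_mem x)) h0 fun w hw hw0 => ?_
  by_contra hlt
  exact hlt (next_le ((h w (abs_lt.2 ⟨by linarith, by linarith⟩)).2 hw) hw0)

theorem Agree.prev_eq_of_mem {R : ℝ} {P Q : Tiling} (h : Agree R P Q) {x : ℝ} (hx : x ≤ R)
    (hn : -R < P.prev x) : Q.prev x = P.prev x := by
  rw [agree_iff] at h
  have h0 := P.prev_lt x
  refine Tiling.prev_eq ((h _ (abs_lt.2 ⟨hn, by linarith⟩)).1 (P.prev_mem x)) h0 fun w hw hw0 => ?_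
  by_contra hlt
  exact hlt (le_prev ((h w (abs_lt.2 ⟨by linarith, by linarith⟩)).2 hw) hw0)

theorem GapLE.translate {P : Tiling} {L : ℝ} (h : P.GapLE L) (y : ℝ) : (P.translate y).GapLE L := by
  intro x
  rw [next_translate]
  linarith [h (x + y)]

theorem GapLE.next_iterate_mem_Icc {P : Tiling} {L : ℝ} (h : P.GapLE L) (x : ℝ) (i : ℕ) :
    x ≤ P.next^[i] x ∧ P.next^[i] x ≤ x + i * L := by
  induction i with
  | zero => simp
  | succ i ih =>
    rw [Function.iterate_succ_apply']
    have h1 := P.lt_next (P.next^[i] x)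
    have h2 := h (P.next^[i] x)
    push_cast
    constructor <;> linarith

theorem GapLE.prev_iterate_mem_Icc {P : Tiling} {L : ℝ} (h : P.GapLE L) (x : ℝ) (i : ℕ) :
    x - i * L ≤ P.prev^[i] x ∧ P.prev^[i] x ≤ x := by
  induction i with
  | zero => simp
  | succ i ih =>
    rw [Function.iterate_succ_apply']
    have h1 := P.prev_lt (P.prev^[i] x)
    have h2 := h.sub_le_prev (P.prev^[i] x)
    push_cast
    constructor <;> linarith

theorem Agree.next_iterate_eq {R L : ℝ} {P Q : Tiling} (h : Agree R P Q) (hL : P.GapLE L) {x : ℝ}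
    (hx : -R ≤ x) (i : ℕ) (hi : x + i * L < R) : Q.next^[i] x = P.next^[i] x := by
  induction i with
  | zero => rfl
  | succ i ih =>
    push_cast at hi
    have hb := hL.next_iterate_mem_Icc x i
    rw [Function.iterate_succ_apply', Function.iterate_succ_apply', ih (by linarith [hL.pos])]
    exact h.next_eq_of_mem (by linarith) (by linarith [hL (P.next^[i] x)])

theorem Agree.prev_iterate_eq {R L : ℝ} {P Q : Tiling} (h : Agree R P Q) (hL : P.GapLE L) {x : ℝ}
    (hx : x ≤ R) (i : ℕ) (hi : -R < x - i * L) : Q.prev^[i] x = P.prev^[i] x := by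
  induction i with
  | zero => rfl
  | succ i ih =>
    push_cast at hi
    have hb := hL.prev_iterate_mem_Icc x i
    rw [Function.iterate_succ_apply', Function.iterate_succ_apply', ih (by linarith [hL.pos])]
    exact h.prev_eq_of_mem (by linarith) (by linarith [hL.sub_le_prev (P.prev^[i] x)])

theorem next_iterate_translate (P : Tiling) (x y : ℝ) (i : ℕ) :
    (P.translate y).next^[i] x = P.next^[i] (x + y) - y := by
  induction i with
  | zero => simp
  | succ i ih =>
    rw [Function.iterate_succ_apply', ih, next_translate, sub_add_cancel,
      Function.iterate_succ_apply']

theorem prev_iterate_translate (P : Tiling) (x y : ℝ) (i : ℕ) :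
    (P.translate y).prev^[i] x = P.prev^[i] (x + y) - y := by
  induction i with
  | zero => simp
  | succ i ih =>
    rw [Function.iterate_succ_apply', ih, prev_translate, sub_add_cancel,
      Function.iterate_succ_apply']

/-- The last vertex `v` with `v ≤ x`. -/
noncomputable def tileStart (P : Tiling) (x : ℝ) : P.vertices := ⟨P.prev (P.next x), P.prev_mem _⟩

theorem tileStart_le (P : Tiling) (x : ℝ) : (P.tileStart x : ℝ) ≤ x := by
  by_contra h
  linarith [next_le (P.tileStart x).2 (not_le.1 h), P.prev_lt (P.next x),
    show (P.tileStart x : ℝ) = P.prev (P.next x) from rfl]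

theorem tileStart_eq {P : Tiling} {v : P.vertices} {x : ℝ} (h1 : (v : ℝ) ≤ x) (h2 : x < P.next v) :
    P.tileStart x = v := by
  have e : P.next x = P.next v :=
    Tiling.next_eq (P.next_mem _) h2 fun w hw hxw => next_le hw (h1.trans_lt hxw)
  refine Subtype.ext ?_
  change P.prev (P.next x) = v
  rw [e, prev_next v.2]

theorem next_tileStart (P : Tiling) (x : ℝ) : P.next (P.tileStart x) = P.next x :=
  next_prev (P.next_mem x)

/-- Every vertex involved is reached in at most `k + 1` steps of length at most `L`, to the right
from `x` or to the left from `P.next x`. The radius `(k + 2) * L` leaves room for the strict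
inequalities. -/
theorem sameNeighborhood_of_agree {P : Tiling} {L : ℝ} (hL : P.GapLE L) (k : ℕ) {x y : ℝ}
    (h : Agree ((k + 2) * L) (P.translate x) (P.translate y)) :
    (P.tileStart x : ℝ) - x = P.tileStart y - y ∧
      P.SameNeighborhood k (P.tileStart x) (P.next x) (P.tileStart y) (P.next y) := by
  have hL0 := hL.pos
  have hnext : ∀ j ≤ k, P.next^[j] (P.next x) - x = P.next^[j] (P.next y) - y := by
    intro j hj
    have hj' : (j : ℝ) ≤ k := by exact_mod_cast hj
    have := h.next_iterate_eq (hL.translate x) (x := 0) (by nlinarith) (j + 1)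
      (by push_cast; nlinarith)
    rw [next_iterate_translate, next_iterate_translate, zero_add, zero_add] at this
    exact this.symm
  have e0 : P.next x - x = P.next y - y := hnext 0 (by omega)
  have hprev : ∀ j ≤ k, P.prev^[j] (P.tileStart x) - x = P.prev^[j] (P.tileStart y) - y := by
    intro j hj
    have hj' : (j : ℝ) ≤ k := by exact_mod_cast hj
    have := h.prev_iterate_eq (hL.translate x) (x := P.next x - x) (by nlinarith [hL x]) (j + 1)
      (by push_cast; nlinarith [P.lt_next x])
    rw [prev_iterate_translate, prev_iterate_translate, sub_add_cancel, e0, sub_add_cancel] at this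
    exact this.symm
  have e1 : (P.tileStart x : ℝ) - x = P.tileStart y - y := hprev 0 (by omega)
  refine ⟨e1, by linarith, fun j hj => ⟨?_, ?_⟩⟩
  · linarith [hnext j hj]
  · linarith [hprev j hj]

/-! ### From simplicial cochains to forms -/

section BumpForm

variable (P : Tiling) (ρ : ℝ → ℝ)

/-- The function equal to `c t * ρ (x - a)` on each tile `t = [a, b]`. -/
noncomputable def bumpForm (c : P.BddCochain₁) (x : ℝ) : ℝ :=
  c (P.tileAt (P.tileStart x)) * ρ (x - P.tileStart x)

variable {P ρ} {m : ℝ}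

theorem bumpForm_sub (c d : P.BddCochain₁) :
    P.bumpForm ρ (c - d) = P.bumpForm ρ c - P.bumpForm ρ d :=
  funext fun _ => sub_mul _ _ _

/-- Since `ρ` vanishes near the ends of every tile, the form is locally a multiple of one translate
of `ρ`, even across a vertex. Smoothness and derivative bounds are then those of `ρ`. -/
theorem bumpForm_eventuallyEq (hm : ∀ v ∈ P.vertices, ∀ w ∈ P.vertices, v < w → v + m ≤ w)
    (hm0 : 0 < m) (hρ : Function.support ρ ⊆ Set.Ioo (m / 4) (3 * m / 4)) (c : P.BddCochain₁)
    (x : ℝ) : P.bumpForm ρ c =ᶠ[nhds x]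
      fun y => c (P.tileAt (P.tileStart x)) * ρ (y - P.tileStart x) := by
  have h1 := P.tileStart_le x
  have h2 := P.lt_next x
  have hz : ∀ y, y ∉ Set.Ioo (m / 4) (3 * m / 4) → ρ y = 0 := fun y hy =>
    Function.notMem_support.1 fun h => hy (hρ h)
  filter_upwards [Ioo_mem_nhds (show (P.tileStart x : ℝ) - m / 4 < x by linarith) h2] with y hy
  by_cases hxy : (P.tileStart x : ℝ) ≤ y
  · rw [bumpForm, tileStart_eq hxy (by rw [next_tileStart]; exact hy.2)]
  · have hlt := (P.tileStart_le y).trans_lt (not_le.1 hxy)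
    have := hm _ (P.tileStart y).2 _ (P.tileStart x).2 hlt
    rw [bumpForm, hz (y - P.tileStart y) fun h => by linarith [h.2, hy.1],
      hz (y - P.tileStart x) fun h => by linarith [h.1, not_le.1 hxy], mul_zero, mul_zero]

theorem abs_iteratedDeriv_bumpForm_le
    (hm : ∀ v ∈ P.vertices, ∀ w ∈ P.vertices, v < w → v + m ≤ w)
    (hm0 : 0 < m) (hρ : Function.support ρ ⊆ Set.Ioo (m / 4) (3 * m / 4)) {j : ℕ} {B : ℝ}
    (hB : ∀ x, |iteratedDeriv j ρ x| ≤ B) (c : P.BddCochain₁) (x : ℝ) :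
    |iteratedDeriv j (P.bumpForm ρ c) x| ≤ ‖c‖ * B := by
  rw [(bumpForm_eventuallyEq hm hm0 hρ c x).iteratedDeriv_eq, iteratedDeriv_const_mul_field,
    iteratedDeriv_comp_sub_const, abs_mul]
  exact mul_le_mul (lp.norm_apply_le_norm ENNReal.top_ne_zero c _) (hB _) (abs_nonneg _)
    (norm_nonneg _)

theorem exists_bound_iteratedDeriv (hρc : ContDiff ℝ (⊤ : ℕ∞) ρ) (hρ : HasCompactSupport ρ)
    (j : ℕ) : ∃ B, ∀ x, |iteratedDeriv j ρ x| ≤ B := by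
  obtain ⟨B, hB⟩ := (hρ.iteratedFDeriv (𝕜 := ℝ) j).exists_bound_of_continuous
    (hρc.continuous_iteratedFDeriv (by exact_mod_cast le_top))
  exact ⟨B, fun x => by
    rw [← Real.norm_eq_abs, ← norm_iteratedFDeriv_eq_norm_iteratedDeriv]; exact hB x⟩

theorem bumpForm_mem_bddSmooth (hm : ∀ v ∈ P.vertices, ∀ w ∈ P.vertices, v < w → v + m ≤ w)
    (hm0 : 0 < m) (hρ : Function.support ρ ⊆ Set.Ioo (m / 4) (3 * m / 4))
    (hρc : ContDiff ℝ (⊤ : ℕ∞) ρ) (hρs : HasCompactSupport ρ) (c : P.BddCochain₁) :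
    P.bumpForm ρ c ∈ BddSmooth := by
  refine ⟨contDiff_iff_contDiffAt.2 fun x => ?_, fun j => ?_⟩
  · refine ContDiffAt.congr_of_eventuallyEq ?_ (bumpForm_eventuallyEq hm hm0 hρ c x)
    exact (contDiff_const.mul (hρc.comp (contDiff_id.sub contDiff_const))).contDiffAt
  · obtain ⟨B, hB⟩ := exists_bound_iteratedDeriv hρc hρs j
    exact ⟨_, abs_iteratedDeriv_bumpForm_le hm hm0 hρ hB c⟩

theorem bumpForm_mem_wPEForm {L : ℝ} (hL : P.GapLE L)
    (hm : ∀ v ∈ P.vertices, ∀ w ∈ P.vertices, v < w → v + m ≤ w)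
    (hm0 : 0 < m) (hρ : Function.support ρ ⊆ Set.Ioo (m / 4) (3 * m / 4))
    (hρc : ContDiff ℝ (⊤ : ℕ∞) ρ) (hρs : HasCompactSupport ρ) {c : P.BddCochain₁}
    (hc : c ∈ P.wPECochain₁) : P.bumpForm ρ c ∈ P.wPEForm := by
  refine ⟨bumpForm_mem_bddSmooth hm hm0 hρ hρc hρs c, fun k ε hε => ?_⟩
  choose B hB using exists_bound_iteratedDeriv hρc hρs
  have hB0 : ∀ j, 0 ≤ B j := fun j => (abs_nonneg _).trans (hB j 0)
  -- One constant dominating the derivative bounds of all orders up to `k`, so that a single uniform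
  -- approximation of `c` controls the seminorm `s_k`.
  set M := ∑ j ∈ Finset.range (k + 1), B j
  have hM : 0 ≤ M := Finset.sum_nonneg fun j _ => hB0 j
  obtain ⟨d, ⟨l, hd⟩, hcd⟩ := Metric.mem_closure_iff.1 hc (ε / (M + 1)) (by positivity)
  refine ⟨P.bumpForm ρ d, ⟨bumpForm_mem_bddSmooth hm hm0 hρ hρc hρs d, (l + 2) * L,
    mul_pos (by positivity) hL.pos, fun x y h => ?_⟩, fun j hj x => ?_⟩
  · obtain ⟨e1, e2⟩ := sameNeighborhood_of_agree hL l h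
    rw [bumpForm, bumpForm, show x - P.tileStart x = y - P.tileStart y by linarith,
      hd (P.tileAt (P.tileStart x)) (P.tileAt (P.tileStart y))]
    simpa only [tileAt, next_tileStart] using e2
  · rw [← bumpForm_sub]
    refine (abs_iteratedDeriv_bumpForm_le hm hm0 hρ (hB j) _ x).trans ?_
    rw [dist_eq_norm, lt_div_iff₀ (by positivity)] at hcd
    have : B j ≤ M := Finset.single_le_sum (fun i _ => hB0 i) (by simpa [Nat.lt_succ_iff] using hj)
    nlinarith [norm_nonneg (c - d)]

theorem integral_bumpForm (hm : ∀ v ∈ P.vertices, ∀ w ∈ P.vertices, v < w → v + m ≤ w)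
    (hm0 : 0 < m) (hρ : Function.support ρ ⊆ Set.Ioo (m / 4) (3 * m / 4)) (hint : ∫ x, ρ x = 1)
    (c : P.BddCochain₁) (v : P.vertices) :
    ∫ x in (v : ℝ)..P.next v, P.bumpForm ρ c x = c (P.tileAt v) := by
  have hv := hm _ v.2 _ (P.next_mem v) (P.lt_next v)
  have h1 : ∫ x in (v : ℝ)..P.next v, P.bumpForm ρ c x =
      ∫ x in (v : ℝ)..P.next v, c (P.tileAt v) * ρ (x - v) := by
    refine intervalIntegral.integral_congr_Ioo_of_le (P.lt_next v).le fun x hx => ?_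
    rw [bumpForm, tileStart_eq hx.1.le hx.2]
  have h2 : Function.support (fun x => ρ (x - v)) ⊆ Set.Ioc (v : ℝ) (P.next v) := by
    intro x hx
    have := hρ (show x - v ∈ Function.support ρ from hx)
    exact ⟨by linarith [this.1], by linarith [this.2]⟩
  rw [h1, intervalIntegral.integral_const_mul,
    intervalIntegral.integral_eq_integral_of_support_subset h2,
    MeasureTheory.integral_sub_right_eq_self ρ (v : ℝ), hint, mul_one]

end BumpForm

/-! ### Weak pattern equivariant de Rham cohomology -/

/-- The restriction of a bounded function to the vertices. -/
noncomputable def restrictVertices (P : Tiling) {g : ℝ → ℝ} (hg : g ∈ BddSmooth) : P.BddCochain₀ :=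
  ⟨fun v => g v, by
    obtain ⟨C, hC⟩ := hg.2 0
    refine memℓp_infty ⟨C, ?_⟩
    rintro _ ⟨v, rfl⟩
    simpa using hC v⟩

/-- Only uniform approximation, the case `k = 0` of the seminorms, is needed; finite local
complexity turns a radius of pattern equivariance into a number of tiles. -/
theorem restrictVertices_mem_wPECochain₀ {P : Tiling} (hfd : P.FiniteDifferences) {g : ℝ → ℝ}
    (hg : g ∈ P.wPEForm) : P.restrictVertices hg.1 ∈ P.wPECochain₀ := by
  refine Metric.mem_closure_iff.2 fun ε hε => ?_
  obtain ⟨u, ⟨hu, R, -, hR⟩, hug⟩ := hg.2 0 (ε / 2) (by positivity)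
  obtain ⟨k, hk⟩ := hfd.exists_agree_of_sameNeighborhood R
  refine ⟨P.restrictVertices hu, ⟨k, fun v w h => hR _ _ (hk v v.2 w w.2 h)⟩, ?_⟩
  rw [dist_eq_norm]
  refine (lp.norm_le_of_forall_le (by positivity) fun v => ?_).trans_lt (half_lt_self hε)
  have := hug 0 le_rfl v
  rwa [iteratedDeriv_zero] at this

/-- If the form built from `c` is `dg`, then integrating over each tile shows that `c` is the
coboundary of `g` restricted to the vertices. Infinitely many simplicial classes therefore stay
independent as forms. -/
theorem not_finite_weakPEdeRhamH1 {P : Tiling} (hfd : P.FiniteDifferences) {L : ℝ}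
    (hL : P.GapLE L) (hP : P.Aperiodic) : ¬ Module.Finite ℝ P.WeakPEdeRhamH1 := by
  intro hfin
  obtain ⟨m, hm0, hm⟩ := hfd.exists_gap
  let b : ContDiffBump (m / 2) := ⟨m / 8, m / 4, by positivity, by linarith⟩
  set ρ : ℝ → ℝ := b.normed MeasureTheory.volume
  have hρ : Function.support ρ ⊆ Set.Ioo (m / 4) (3 * m / 4) := by
    rw [b.support_normed_eq, Real.ball_eq_Ioo]
    exact Set.Ioo_subset_Ioo (by change _ ≤ m / 2 - m / 4; linarith)
      (by change m / 2 + m / 4 ≤ _; linarith)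
  have hρc : ContDiff ℝ (⊤ : ℕ∞) ρ := b.contDiff_normed
  have hρs : HasCompactSupport ρ := b.hasCompactSupport_normed
  have hint : ∫ x, ρ x = 1 := b.integral_normed
  let J : P.wPECochain₁ →ₗ[ℝ] P.wPEForm :=
    { toFun := fun c => ⟨P.bumpForm ρ c, bumpForm_mem_wPEForm hL hm hm0 hρ hρc hρs c.2⟩
      map_add' := fun c d => Subtype.ext (funext fun x => add_mul _ _ _)
      map_smul' := fun r c => Subtype.ext (funext fun x => mul_assoc _ _ _) }
  refine not_finite_weakPESimplicialH1 hfd hP (finite_quotient_of_comap_le J ?_ hfin)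
  rintro c ⟨g, hg, hgc⟩
  refine ⟨P.restrictVertices hg.1, restrictVertices_mem_wPECochain₀ hfd hg, ?_⟩
  have hgc : deriv g = P.bumpForm ρ c := hgc
  refine lp.ext (funext fun t => ?_)
  obtain ⟨v, rfl⟩ := exists_eq_tileAt t
  have hcont : Continuous (P.bumpForm ρ c) :=
    (bumpForm_mem_bddSmooth hm hm0 hρ hρc hρs c.1).1.continuous
  have := intervalIntegral.integral_deriv_eq_sub' (a := (v : ℝ)) (b := P.next v) g hgc
    (fun x _ => (hg.1.1.differentiable (by simp)).differentiableAt) hcont.continuousOn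
  rw [integral_bumpForm hm hm0 hρ hint] at this
  exact this.symm

end Tiling

/-! ### Cut and project tilings -/

theorem eq_zero_of_add_mul_eq_zero {θ : ℝ} (hθ : Irrational θ) {a b : ℤ} (h : (a : ℝ) + b * θ = 0) :
    a = 0 ∧ b = 0 := by
  have hb : b = 0 := by
    by_contra hb
    exact ((hθ.intCast_mul hb).intCast_add a).ne_zero h
  subst hb
  simpa using h

theorem projPar_injective {θ : ℝ} (hθ : Irrational θ) {m n p q : ℤ}
    (h : projPar θ m n = projPar θ p q) : m = p ∧ n = q := by
  have hs : √(1 + θ ^ 2) ≠ 0 := (Real.sqrt_pos.2 (by positivity)).ne'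
  rw [projPar, projPar, div_left_inj' hs] at h
  have := eq_zero_of_add_mul_eq_zero hθ (a := m - p) (b := n - q) (by push_cast; linarith)
  omega

theorem eq_zero_of_projPerp_eq_zero {θ : ℝ} (hθ : Irrational θ) {m n : ℤ}
    (h : projPerp θ m n = 0) : m = 0 ∧ n = 0 := by
  have hs : √(1 + θ ^ 2) ≠ 0 := (Real.sqrt_pos.2 (by positivity)).ne'
  rw [projPerp, div_eq_zero_iff, or_iff_left hs] at h
  have := eq_zero_of_add_mul_eq_zero hθ (a := n) (b := -m) (by push_cast; linarith)
  omega

theorem projPerp_zsmul (θ : ℝ) (k m n : ℤ) : projPerp θ (k * m) (k * n) = k * projPerp θ m n := by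
  simp only [projPerp]; push_cast; ring

theorem projPar_zsmul (θ : ℝ) (k m n : ℤ) : projPar θ (k * m) (k * n) = k * projPar θ m n := by
  simp only [projPar]; push_cast; ring

/-- There are lattice points close to the line on both of its sides, lying in the same direction. -/
theorem exists_projPerp_pos_neg {θ : ℝ} (hθ : Irrational θ) {δ : ℝ} (hδ : 0 < δ) :
    ∃ p q p' q' : ℤ, 0 < projPar θ p q ∧ 0 < projPar θ p' q' ∧
      0 < projPerp θ p q ∧ projPerp θ p q < δ ∧ projPerp θ p' q' < 0 ∧ -δ < projPerp θ p' q' := by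
  have hne : ∀ p q, 0 < projPar θ p q → projPerp θ p q ≠ 0 := by
    intro p q hpq h
    obtain ⟨rfl, rfl⟩ := eq_zero_of_projPerp_eq_zero hθ h
    simp [projPar] at hpq
  obtain ⟨p, q, h1, h2⟩ := exists_projPar_gt θ hδ 0
  -- A second point, farther along `E` and strictly closer to it than the first. If both lie on the
  -- same side, their difference lies on the opposite side and still points forward.
  obtain ⟨p', q', h3, h4⟩ := exists_projPar_gt θ (abs_pos.2 (hne p q h2)) (projPar θ p q)
  have hd : projPar θ (p' + -p) (q' + -q) = projPar θ p' q' - projPar θ p q := by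
    rw [projPar_add, projPar_neg, sub_eq_add_neg]
  have he : projPerp θ (p' + -p) (q' + -q) = projPerp θ p' q' - projPerp θ p q := by
    rw [projPerp_add, projPerp_neg, sub_eq_add_neg]
  have h1' := abs_lt.1 h1
  rcases lt_or_gt_of_ne (hne p q h2) with h | h
  · rw [abs_of_neg h, abs_lt] at h3
    rcases lt_or_gt_of_ne (hne p' q' (h2.trans h4)) with h' | h'
    · exact ⟨p' + -p, q' + -q, p, q, by linarith, h2, by linarith, by linarith, h, h1'.1⟩
    · exact ⟨p', q', p, q, by linarith, h2, h', by linarith, h, h1'.1⟩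
  · rw [abs_of_pos h, abs_lt] at h3
    rcases lt_or_gt_of_ne (hne p' q' (h2.trans h4)) with h' | h'
    · exact ⟨p, q, p', q', h2, by linarith, h, h1'.2, h', by linarith⟩
    · exact ⟨p, q, p' + -p, q' + -q, h2, by linarith, h, h1'.2, by linarith, by linarith⟩

/-- The lattice points close to the line are relatively dense along it. -/
theorem exists_projPar_mem_Ioc {θ : ℝ} (hθ : Irrational θ) {δ : ℝ} (hδ : 0 < δ) :
    ∃ L, ∀ x, ∃ p q : ℤ, |projPerp θ p q| < δ ∧ x < projPar θ p q ∧ projPar θ p q ≤ x + L := by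
  obtain ⟨p, q, p', q', h1, h2, h3, h4, h5, h6⟩ := exists_projPerp_pos_neg hθ hδ
  refine ⟨max (projPar θ p q) (projPar θ p' q'), fun x => ?_⟩
  set A : Set ℝ := {v | ∃ m n : ℤ, |projPerp θ m n| < δ ∧ v = projPar θ m n}
  obtain ⟨a, b, ha, hb⟩ := exists_projPar_gt θ hδ (-x)
  have hfin : (A ∩ Set.Icc (-projPar θ a b) x).Finite := by
    refine (cutProjectSet_finite θ (isCompact_Icc (a := -δ) (b := δ))
      (|x| + |projPar θ a b|)).subset ?_
    rintro _ ⟨⟨m, n, hmn, rfl⟩, h, h'⟩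
    refine ⟨⟨m, n, abs_le.1 hmn.le, rfl⟩, ?_, ?_⟩
    · linarith [le_abs_self (projPar θ a b), abs_nonneg x]
    · linarith [le_abs_self x, abs_nonneg (projPar θ a b)]
  -- The last point of the strip not beyond `x`. Adding whichever step vector points back across `E`
  -- stays in the strip and must pass `x`, by maximality.
  obtain ⟨_, ⟨⟨m, n, hmn, rfl⟩, hle, hle'⟩, hmax⟩ := Set.exists_max_image _ id hfin
    ⟨-projPar θ a b, ⟨-a, -b, by rwa [projPerp_neg, abs_neg], (projPar_neg θ a b).symm⟩,
      le_rfl, by linarith⟩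
  have hstep : ∀ c d, 0 < projPar θ c d → |projPerp θ (m + c) (n + d)| < δ →
      x < projPar θ (m + c) (n + d) := by
    intro c d hcd h
    by_contra hlt
    have := hmax (projPar θ (m + c) (n + d))
      ⟨⟨_, _, h, rfl⟩, by rw [projPar_add]; linarith, not_lt.1 hlt⟩
    simp only [id, projPar_add] at this
    linarith
  have hmn' := abs_lt.1 hmn
  rcases le_total 0 (projPerp θ m n) with h0 | h0
  · have h : |projPerp θ (m + p') (n + q')| < δ := by
      rw [projPerp_add, abs_lt]; constructor <;> linarith
    refine ⟨_, _, h, hstep _ _ h2 h, ?_⟩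
    rw [projPar_add]
    linarith [le_max_right (projPar θ p q) (projPar θ p' q')]
  · have h : |projPerp θ (m + p) (n + q)| < δ := by
      rw [projPerp_add, abs_lt]; constructor <;> linarith
    refine ⟨_, _, h, hstep _ _ h1 h, ?_⟩
    rw [projPar_add]
    linarith [le_max_left (projPar θ p q) (projPar θ p' q')]

/-! ### The three standing properties for cut and project tilings -/

section

variable (θ : ℝ) (hθ : Irrational θ) (K : Set ℝ) (hK : IsCompact K)
  (hreg : closure (interior K) = K) (hne : K.Nonempty)

open Pointwise in
theorem finiteDifferences_cutProjectTiling :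
    (cutProjectTiling θ hθ K hK hreg hne).FiniteDifferences := by
  intro r
  refine (cutProjectSet_finite θ (hK.add hK.neg) r).subset (Set.inter_subset_inter_left _ ?_)
  rintro _ ⟨_, ⟨m, n, hmn, rfl⟩, _, ⟨p, q, hpq, rfl⟩, rfl⟩
  refine ⟨m + -p, n + -q, ?_, ?_⟩
  · rw [projPerp_add, projPerp_neg]
    exact Set.add_mem_add hmn (Set.neg_mem_neg.2 hpq)
  · rw [projPar_add, projPar_neg, ← sub_eq_add_neg]

/-- Around some projected lattice point the window contains a whole interval, so adding any lattice
point close enough to `E` gives a vertex; such lattice points are relatively dense along `E`. -/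
theorem exists_gapLE_cutProjectTiling :
    ∃ L, (cutProjectTiling θ hθ K hK hreg hne).GapLE L := by
  obtain ⟨m, n, δ, hδ, h⟩ := exists_cutProject hθ hreg hne
  obtain ⟨L, hL⟩ := exists_projPar_mem_Ioc hθ hδ
  refine ⟨L, fun x => ?_⟩
  obtain ⟨p, q, hpq, h1, h2⟩ := hL (x - projPar θ m n)
  refine (Tiling.next_le (P := cutProjectTiling θ hθ K hK hreg hne)
    (v := projPar θ (m + p) (n + q)) ⟨_, _, h p q hpq, rfl⟩ ?_).trans ?_ <;>
  · rw [projPar_add]; linarith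

/-- A period is the projection of a lattice vector, and injectivity of the projection lifts the
vertices `v + k x` to an arithmetic progression of lattice points. Its perpendicular part remains
bounded only if that vector lies in `E`, hence is zero by irrationality. -/
theorem aperiodic_cutProjectTiling : (cutProjectTiling θ hθ K hK hreg hne).Aperiodic := by
  intro x hx
  set P := cutProjectTiling θ hθ K hK hreg hne with hP
  obtain ⟨v, hv, -⟩ := P.unbounded_above 0
  have hstep : ∀ w, w ∈ P.vertices → w + x ∈ P.vertices := fun w hw => by
    rw [← hx] at hw; exact hw
  have hk : ∀ k : ℕ, v + k * x ∈ P.vertices := by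
    intro k
    induction k with
    | zero => simpa using hv
    | succ k ih =>
      have := hstep _ ih
      push_cast
      rwa [add_mul, one_mul, ← add_assoc]
  obtain ⟨m, n, hmn, rfl⟩ := hv
  obtain ⟨m', n', hmn', e⟩ := hk 1
  have ex : x = projPar θ (m' + -m) (n' + -n) := by
    rw [projPar_add, projPar_neg]
    push_cast at e
    linarith
  set p := m' + -m
  set q := n' + -n
  obtain ⟨M, hM⟩ := hK.isBounded.exists_norm_le
  have hb : ∀ k : ℕ, |projPerp θ m n + k * projPerp θ p q| ≤ M := by
    intro k
    obtain ⟨a, b, hab, e⟩ := hk k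
    have : projPar θ (m + (k : ℤ) * p) (n + (k : ℤ) * q) = projPar θ a b := by
      rw [← e, projPar_add, projPar_zsmul, ex]; simp
    obtain ⟨rfl, rfl⟩ := projPar_injective hθ this
    rw [projPerp_add, projPerp_zsmul] at hab
    simpa using hM _ hab
  have hz : projPerp θ p q = 0 := by
    by_contra hz
    obtain ⟨k, hk⟩ := exists_nat_gt (2 * M / |projPerp θ p q|)
    rw [div_lt_iff₀ (abs_pos.2 hz)] at hk
    have h1 := hb k
    have h2 := hb 0
    have h3 := abs_sub (projPerp θ m n + k * projPerp θ p q) (projPerp θ m n)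
    rw [add_sub_cancel_left, abs_mul, Nat.abs_cast] at h3
    simp only [Nat.cast_zero, zero_mul, add_zero] at h2
    linarith
  obtain ⟨hp, hq⟩ := eq_zero_of_projPerp_eq_zero hθ hz
  rw [ex, hp, hq]
  simp [projPar]

end

end TilingCohomology

theorem mainTheorem4 (θ : ℝ) (hθ : Irrational θ) (K : Set ℝ) (hK : IsCompact K)
    (hreg : closure (interior K) = K) (hne : K.Nonempty)
    (hgen : ∀ m n : ℤ, TilingCohomology.projPerp θ m n ∉ frontier K) :
    ¬ Module.Finite ℝ (TilingCohomology.cutProjectTiling θ hθ K hK hreg hne).WeakPVH1 ∧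
    ¬ Module.Finite ℝ (TilingCohomology.cutProjectTiling θ hθ K hK hreg hne).WeakPESimplicialH1 ∧
    ¬ Module.Finite ℝ (TilingCohomology.cutProjectTiling θ hθ K hK hreg hne).WeakPEdeRhamH1 ∧
    ¬ Module.Finite ℝ (TilingCohomology.cutProjectTiling θ hθ K hK hreg hne).ReturnH1 := by
  have hfd := TilingCohomology.finiteDifferences_cutProjectTiling θ hθ K hK hreg hne
  obtain ⟨L, hL⟩ := TilingCohomology.exists_gapLE_cutProjectTiling θ hθ K hK hreg hne
  have hP := TilingCohomology.aperiodic_cutProjectTiling θ hθ K hK hreg hne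
  have := TilingCohomology.Tiling.compactSpace_transversal₀ hfd hL
  exact ⟨TilingCohomology.Tiling.not_finite_weakPVH1 hP,
    TilingCohomology.Tiling.not_finite_weakPESimplicialH1 hfd hP,
    TilingCohomology.Tiling.not_finite_weakPEdeRhamH1 hfd hL hP,
    TilingCohomology.Tiling.not_finite_returnH1 hP⟩
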